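/- Let $n\ge 1$. For a strict partition $\mu=(\mu_1>\dots>\mu_r>0)$ let its shifted diagram be $\{(i,j): 1\le i\le r,\ i\le j\le \mu_i+i-1\}$. A shifted set-valued tableau $T$ of shape $\mu$ assigns to every box a nonempty subset $T_{i,j}$ of the ordered alphabet $1'<1<2'<2<\dots<n'<n$ such that $\max T_{i,j}\le\min T_{i,j+1}$ and $\max T_{i,j}\le \min T_{i+1,j}$, each unprimed letter $s$ occurs at most once in each column, each primed letter $s'$ occurs at most once in each row, and the diagonal boxes $(i,i)$ contain only unprimed letters. Let $|T|=\sum_{i,j}|T_{i,j}|$ and let $\omega_s(T)$ be the total number of occurrences of $s$ and $s'$ in $T$. The $K$-theoretic Schur $P$-function is $$GP_\mu(x_1,\dots,x_n\mid b)=\sum_{T} b^{|T|-|\mu|}\prod_{s=1}^n x_s^{\omega_s(T)},$$ the sum running over all shifted set-valued tableaux $T$ of shape $\mu$. For a partition $\lambda$ with at most $n$ nonzero parts put $A_{ij}=\lambda_i-\lambda_j+j-i$ and $$F^{(n)}_\lambda(t)=\sum_{\kappa_1,\dots,\kappa_n\ge 0}\ \prod_{1\le i<j\le n}\frac{A_{ij}+\kappa_i-\kappa_j}{A_{ij}}\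 \prod_{i=1}^n\frac{(1-i)_{\kappa_i}}{(1)_{\kappa_i}}\,t^{\kappa_i},$$ where $(a)_m=a(a+1)\cdots(a+m-1)$; this is a Holman hypergeometric series, and it terminates. For $p,q\in\mathbb C$ let $$P_k^{(p,q)}(z)=\sum_{r=0}^k\binom{k+p}{k-r}\binom{k+q}{r}\Bigl(\frac{z-1}2\Bigr)^r\Bigl(\frac{z+1}2\Bigr)^{k-r}$$ be the Jacobi polynomial. For $k\ge1$ let $\delta_k=(k-1,k-2,\dots,1)$, and write $\tilde\delta_k$ for the same sequence regarded as a strict partition. **Proposition 4.9.** Let $1\le k\le n$, and put $p=\frac{n-k-1}{2}$, $q=\frac{-n-k-1}{2}$. Then, with $n$ variables equal to $1$, $$\frac{GP_{\tilde\delta_{k+1}}(1,\dots,1\mid b)}{GP_{\tilde\delta_k}(1,\dots,1\mid b)}=\frac{2^{2k}(k!)^2}{(2k)!}\,P_k^{(p,q)}(-1)\cdot\frac{F^{(n)}_{\delta_{k+1}}(-b)}{F^{(n)}_{\delta_k}(-b)}$$ holds as an identity of rational functions in the indeterminate $b$ over $\mathbb C$, the two denominators being nonzero. Moreover, for every complex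 number $b$ with $GP_{\tilde\delta_k}(1,\dots,1\mid b)\ne0$, one has $F^{(n)}_{\delta_k}(-b)\neq 0$ and the same identity holds in $\mathbb C$. -/

import Mathlib

open Finset

noncomputable section

/-! ### Staircase partitions (rows and columns are numbered from `0`) -/

/-- The list `(k-1, k-2, …, 1)`; it is empty for `k = 1`. -/
def staircaseParts (k : ℕ) : List ℕ := (List.range' 1 (k - 1)).reverse

theorem staircaseParts_pairwise (k : ℕ) : (staircaseParts k).Pairwise (· > ·) := by
  unfold staircaseParts
  rw [List.pairwise_reverse]
  exact List.pairwise_lt_range'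

theorem staircaseParts_pos (k : ℕ) : ∀ m ∈ staircaseParts k, 0 < m := by
  intro m hm
  simp only [staircaseParts, List.mem_reverse, List.mem_range'_1] at hm
  omega

/-- The staircase partition `δ_k = (k-1, k-2, …, 1)`, as a Young diagram. -/
def staircase (k : ℕ) : YoungDiagram :=
  YoungDiagram.ofRowLens (staircaseParts k)
    ((staircaseParts_pairwise k).imp fun h => le_of_lt h).sortedGE

/-- A strict partition `μ₁ > μ₂ > ⋯ > μ_r > 0`. -/
structure StrictPartition where
  parts : List ℕ
  strictAnti : parts.Pairwise (· > ·)
  pos : ∀ m ∈ parts, 0 < m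

/-- The staircase `δ̃_k = (k-1, k-2, …, 1)`, as a strict partition. -/
def strictStaircase (k : ℕ) : StrictPartition :=
  ⟨staircaseParts k, staircaseParts_pairwise k, staircaseParts_pos k⟩

/-- The shifted Young diagram: row `i` consists of the boxes `(i, j)` with
`i ≤ j < i + μ_i`. -/
def StrictPartition.diagram (μ : StrictPartition) : Finset (ℕ × ℕ) :=
  Finset.univ.biUnion fun i : Fin μ.parts.length =>
    {(i : ℕ)} ×ˢ Finset.Ico (i : ℕ) (i + μ.parts[i])

/-! ### `K`-theoretic Schur `P`-functions -/

/-- The alphabet `1' < 1 < 2' < 2 < ⋯ < n' < n` with its total order. -/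
abbrev PrimedAlphabet (n : ℕ) : Type := Fin n ×ₗ Bool

/-- The letter `s'`. -/
def primed {n : ℕ} (s : Fin n) : PrimedAlphabet n := toLex (s, false)

/-- The letter `s`. -/
def unprimed {n : ℕ} (s : Fin n) : PrimedAlphabet n := toLex (s, true)

/-- Shifted semistandard set-valued tableaux of shape `μ` with entries in
`{1', 1, …, n', n}` and no primed letters on the main diagonal. -/
structure IsShiftedSetValuedTableau (n : ℕ) (μ : StrictPartition)
    (T : μ.diagram → Finset (PrimedAlphabet n)) : Prop where
  nonempty : ∀ u, (T u).Nonempty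
  /-- `max T_{i,j} ≤ min T_{i,j+1}` -/
  row_le : ∀ u v, v.1 = (u.1.1, u.1.2 + 1) → ∀ a ∈ T u, ∀ b ∈ T v, a ≤ b
  /-- `max T_{i,j} ≤ min T_{i+1,j}` -/
  col_le : ∀ u v, v.1 = (u.1.1 + 1, u.1.2) → ∀ a ∈ T u, ∀ b ∈ T v, a ≤ b
  /-- an unprimed letter occurs at most once in each column -/
  col_unprimed : ∀ (s : Fin n) (u v), u.1.2 = v.1.2 →
    unprimed s ∈ T u → unprimed s ∈ T v → u = v
  /-- a primed letter occurs at most once in each row -/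
  row_primed : ∀ (s : Fin n) (u v), u.1.1 = v.1.1 →
    primed s ∈ T u → primed s ∈ T v → u = v
  /-- diagonal boxes contain no primed letters -/
  diag : ∀ u, u.1.1 = u.1.2 → ∀ s : Fin n, primed s ∉ T u

open Classical in
/-- The finite set `SSVT_P(μ, n)`. -/
def SSVT (n : ℕ) (μ : StrictPartition) : Finset (μ.diagram → Finset (PrimedAlphabet n)) :=
  Finset.univ.filter (IsShiftedSetValuedTableau n μ)

/-- `|T|`: the total number of letters, primed or not, in `T`. -/
def tableauSize {n : ℕ} {μ : StrictPartition} (T : μ.diagram → Finset (PrimedAlphabet n)) : ℕ :=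
  ∑ u, (T u).card

/-- `ω_s(T)`: the total number of occurrences of `s'` and `s` in `T`. -/
def tableauWeight {n : ℕ} {μ : StrictPartition} (T : μ.diagram → Finset (PrimedAlphabet n))
    (s : Fin n) : ℕ :=
  ∑ u, ((T u).filter fun a => (ofLex a).1 = s).card

/-- The `K`-theoretic Schur `P`-function `GP_μ(x₁, …, x_n | b)` over a commutative ring.
Every tableau satisfies `|T| ≥ |μ|`, so the subtraction of natural numbers is exact. -/
def GP {R : Type*} [CommRing R] {n : ℕ} (μ : StrictPartition) (x : Fin n → R) (b : R) : R :=
  ∑ T ∈ SSVT n μ, b ^ (tableauSize T - μ.parts.sum) * ∏ s, x s ^ tableauWeight T s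

/-! ### Jacobi polynomials -/

/-- The Jacobi polynomial `P_k^{(p,q)}(z)` for arbitrary complex parameters,
`∑_{r ≤ k} binom(k+p, k-r) binom(k+q, r) ((z-1)/2)^r ((z+1)/2)^(k-r)`, where
`Ring.choose` is the generalized binomial coefficient. -/
def jacobiP (k : ℕ) (p q z : ℂ) : ℂ :=
  ∑ r ∈ Finset.range (k + 1),
    Ring.choose ((k : ℂ) + p) (k - r) * Ring.choose ((k : ℂ) + q) r *
      ((z - 1) / 2) ^ r * ((z + 1) / 2) ^ (k - r)

/-! ### Holman hypergeometric functions -/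

/-- The summand of the Holman hypergeometric series `F^{(n)}(A | a | c | z)` at the
multi-index `κ`. -/
def holmanTerm {K : Type*} [Field K] {n v w : ℕ} (A : Fin n → Fin n → K)
    (a : Fin n → Fin v → K) (c : Fin n → Fin w → K) (z : Fin n → K) (κ : Fin n → ℕ) : K :=
  (∏ p : Fin n × Fin n with p.1 < p.2,
      (A p.1 p.2 + (κ p.1 : K) - (κ p.2 : K)) / A p.1 p.2) *
    (∏ j, ∏ i, (ascPochhammer K (κ i)).eval (a i j)) *
    (∏ j, ∏ i, ((ascPochhammer K (κ i)).eval (c i j))⁻¹) *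
    ∏ i, z i ^ κ i

/-- The Holman hypergeometric function `F^{(n)}(A | a | c | z)` for a terminating series,
that is, one with finitely many nonzero terms; such a series makes sense over any field. -/
def holmanF {K : Type*} [Field K] {n v w : ℕ} (A : Fin n → Fin n → K)
    (a : Fin n → Fin v → K) (c : Fin n → Fin w → K) (z : Fin n → K) : K :=
  ∑ᶠ κ : Fin n → ℕ, holmanTerm A a c z κ

/-- A Holman series with upper parameters `0, -1, …, -(n-1)` terminates. -/
theorem holmanTerm_support_finite {K : Type*} [Field K] {n w : ℕ} (A : Fin n → Fin n → K)
    (c : Fin n → Fin w → K) (z : Fin n → K) :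
    (Function.support
      (holmanTerm A (fun i (_ : Fin 1) => -((i : ℕ) : K)) c z)).Finite := by
  refine (Set.finite_Iic (fun _ : Fin n => n)).subset ?_
  intro κ hκ i
  by_contra hlt
  apply hκ
  have h0 : (ascPochhammer K (κ i)).eval (-((i : ℕ) : K)) = 0 :=
    ascPochhammer_eval_neg_coe_nat_of_lt (lt_trans i.2 (not_le.mp hlt))
  have h1 : (∏ j : Fin 1, ∏ i : Fin n,
      (ascPochhammer K (κ i)).eval (-((i : ℕ) : K))) = 0 := by
    simp only [Finset.univ_unique, Finset.prod_const, Finset.card_singleton, pow_one]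
    exact Finset.prod_eq_zero (Finset.mem_univ i) h0
  simp only [holmanTerm, h1, mul_zero, zero_mul]

/-- Over `ℂ`, such a terminating series is the sum of the usual infinite series. -/
theorem hasSum_holmanF {n w : ℕ} (A : Fin n → Fin n → ℂ) (c : Fin n → Fin w → ℂ)
    (z : Fin n → ℂ) :
    HasSum (holmanTerm A (fun i (_ : Fin 1) => -((i : ℕ) : ℂ)) c z)
      (holmanF A (fun i (_ : Fin 1) => -((i : ℕ) : ℂ)) c z) := by
  have hf := holmanTerm_support_finite A c z
  have h := (summable_of_hasFiniteSupport (L := SummationFilter.unconditional _) hf).hasSum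
  rwa [tsum_eq_finsum hf] at h

/-- `F^{(n)}_λ(t)`: the Holman function with `A_{ij} = λ_i - λ_j + j - i`, one column of upper
parameters `0, -1, …, -(n-1)`, one column of lower parameters `1, …, 1`, and all variables
equal to `t`. -/
def holmanShape {K : Type*} [Field K] (n : ℕ) (lam : YoungDiagram) (t : K) : K :=
  holmanF (n := n) (v := 1) (w := 1)
    (fun i j => (lam.rowLen i : K) - (lam.rowLen j : K) + ((j : ℕ) : K) - ((i : ℕ) : K))
    (fun i _ => -((i : ℕ) : K))
    (fun _ _ => 1)
    (fun _ => t)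

end

/-! For the strict staircase with rows r, …, 1 the K-theoretic P-function behaves like the ordinary
symmetric Grothendieck polynomial of the partition δ_{r+1}, a quotient of alternants:
det(x_i^{λ_j+n-j} (1+b x_i)^{j-1}) divided by the Vandermonde product. Expanding the powers of 1+b
x_i binomially and letting all x_i tend to 1 turns this quotient into a Weyl dimension times a
Holman series at -b. The result is `GP_mul_weylDen`: the value of `GP` times `weylDen` is the Holman
value times `weylNum`. Since `weylDen` does not depend on r, the ratio of two consecutive staircases
leaves only a ratio of Weyl numerators, which telescopes (`weylNum_succ`) and is matched with a
Jacobi polynomial at -1 (`jacobiP_neg_one`).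

The determinant formula comes from operators. Building a shape letter by letter is a product of
factors 1 + x U_c, where U_c removes a box of diagonal c; each letter contributes a palindromic
product. The U_c satisfy the relations of `HeckeGenerators`, so the Yang–Baxter and reflection
equations hold. With the group law x ⊕ y = x + y + bxy they make the generating function `stairSum`
symmetric, unchanged when a pair with x ⊕ y = 0 is dropped, of degree at most r in each variable,
and reducible to the staircase with one row fewer at x = -1/b. In the variable w = b + 1/x the
determinant has matching properties (`stairDet_cons_zero`, `stairDet_cancel`), and interpolation in
one variable identifies the two sides (`stairDet_eq_stairRhs`).

Tableaux enter only at x = (1, …, 1): ordering all pairs (letter, diagonal) as successive times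
turns a set-valued tableau into a filling that is strictly increasing in time, and the fillings obey
the recursion of the operators (`timedSum_succ`, `GP_ones_eq_stairSum`). The analysis uses real b >
0; equality at infinitely many b gives an identity of integer polynomials, valid over every field of
characteristic zero. -/

noncomputable section

/-! ### Reflection operators in a quotient of the type B Hecke algebra -/

/-- Generators of a quotient of the 0-Hecke algebra of type B in which the long braid words
vanish. -/
structure HeckeGenerators {A : Type*} [Ring A] [Algebra ℝ A] (b : ℝ) (u : ℕ → A) : Prop where
  sq : ∀ i, u i * u i = b • u i
  comm : ∀ i j, i + 2 ≤ j → u i * u j = u j * u i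
  up : ∀ i, u (i + 1) * u i * u (i + 1) = 0
  down : ∀ i, u (i + 1) * u (i + 2) * u (i + 1) = 0

section Hecke

variable {A : Type*} [Ring A] [Algebra ℝ A] {b : ℝ} {u : ℕ → A}

/-- The factor `1 + x u_i`. -/
def heckeFactor (u : ℕ → A) (i : ℕ) (x : ℝ) : A := 1 + x • u i

/-- The palindromic product `h_{N-1} ⋯ h_1 h_0 h_1 ⋯ h_{N-1}`. -/
def reflectionOp (u : ℕ → A) : ℕ → ℝ → A
  | 0, _ => 1
  | 1, x => heckeFactor u 0 x
  | N + 2, x => heckeFactor u (N + 1) x * reflectionOp u (N + 1) x * heckeFactor u (N + 1) x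

theorem heckeFactor_mul (hu : HeckeGenerators b u) (i : ℕ) (x y : ℝ) :
    heckeFactor u i x * heckeFactor u i y = heckeFactor u i (x + y + b * x * y) := by
  simp only [heckeFactor, mul_add, add_mul, one_mul, mul_one, smul_mul_smul_comm, hu.sq]
  module

theorem generator_comm_reflectionOp (hu : HeckeGenerators b u) :
    ∀ (N j : ℕ) (x : ℝ), N + 1 ≤ j → Commute (u j) (reflectionOp u N x)
  | 0, _, _, _ => Commute.one_right _
  | 1, j, x, h => by
    have : Commute (u j) (u 0) := (hu.comm 0 j (by omega)).symm
    simpa [reflectionOp, heckeFactor] using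
      (Commute.one_right _).add_right (this.smul_right x)
  | N + 2, j, x, h => by
    have h1 : Commute (u j) (heckeFactor u (N + 1) x) :=
      (Commute.one_right _).add_right
        (Commute.smul_right (show Commute _ _ from (hu.comm (N + 1) j (by omega)).symm) x)
    exact (h1.mul_right (generator_comm_reflectionOp hu (N + 1) j x (by omega))).mul_right h1

theorem heckeFactor_comm_reflectionOp (hu : HeckeGenerators b u) {N j : ℕ} (x y : ℝ)
    (h : N + 1 ≤ j) : Commute (heckeFactor u j y) (reflectionOp u N x) :=
  (Commute.one_left _).add_left
    ((generator_comm_reflectionOp hu N j x h).smul_left y)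

/-- The Yang–Baxter equation. -/
theorem heckeFactor_braid (hu : HeckeGenerators b u) (i : ℕ) (x y : ℝ) :
    heckeFactor u (i + 1) x * heckeFactor u (i + 2) (x + y + b * x * y) * heckeFactor u (i + 1) y =
      heckeFactor u (i + 2) y * heckeFactor u (i + 1) (x + y + b * x * y) *
        heckeFactor u (i + 2) x := by
  simp only [heckeFactor, mul_add, add_mul, one_mul, mul_one, smul_mul_smul_comm, hu.sq,
    hu.down, hu.up (i + 1)]
  module

theorem heckeFactor_braid' (hu : HeckeGenerators b u) (i : ℕ) {x y z : ℝ}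
    (hz : x + y + b * x * y = z) :
    heckeFactor u (i + 1) x * heckeFactor u (i + 2) z * heckeFactor u (i + 1) y =
      heckeFactor u (i + 2) y * heckeFactor u (i + 1) z * heckeFactor u (i + 2) x := by
  subst hz; exact heckeFactor_braid hu i x y

/-- The reflection equation. -/
theorem reflection_equation (hu : HeckeGenerators b u) {x y z : ℝ} (hz : z + y + b * z * y = x) :
    ∀ N, heckeFactor u (N + 1) z * reflectionOp u (N + 1) x *
        heckeFactor u (N + 1) (x + y + b * x * y) * reflectionOp u (N + 1) y =
      reflectionOp u (N + 1) y * heckeFactor u (N + 1) (x + y + b * x * y) *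
        reflectionOp u (N + 1) x * heckeFactor u (N + 1) z
  | 0 => by
    -- Words in u₀, u₁ containing u₁u₀u₁ die, so few words survive and the two sides can be compared
    -- coefficientwise once x is replaced by z ⊕ y.
    have e1 : u 1 * u 0 * u 1 = 0 := hu.up 0
    have e0 : u 0 * u 1 * u 0 * u 1 = 0 := by rw [mul_assoc, mul_assoc, ← mul_assoc (u 1), e1, mul_zero]
    have e2 : u 0 * u 1 * u 1 = b • (u 0 * u 1) := by rw [mul_assoc, hu.sq, mul_smul_comm]
    have e3 : u 1 * u 0 * u 0 = b • (u 1 * u 0) := by rw [mul_assoc, hu.sq, mul_smul_comm]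
    simp only [heckeFactor, reflectionOp, zero_add, mul_add, add_mul, one_mul, mul_one,
      smul_mul_assoc, mul_smul_comm, hu.sq, e0, e1, e2, e3, smul_zero, add_zero]
    subst hz
    module
  | N + 1 => by
    have ih := reflection_equation hu hz N
    set w := x + y + b * x * y with hw
    have hw' : y + x + b * y * x = w := by rw [hw]; ring
    have hz' : y + z + b * y * z = x := by rw [← hz]; ring
    have c1 := heckeFactor_comm_reflectionOp hu (N := N + 1) (j := N + 2) x y le_rfl
    have c2 := heckeFactor_comm_reflectionOp hu (N := N + 1) (j := N + 2) y x le_rfl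
    have Y1 := heckeFactor_braid' hu N hw.symm
    have Y2 := heckeFactor_braid' hu N hz'
    have Y3 := heckeFactor_braid' hu N hz
    have Y4 := heckeFactor_braid' hu N hw'
    have R : ∀ t, reflectionOp u (N + 2) t =
      heckeFactor u (N + 1) t * reflectionOp u (N + 1) t * heckeFactor u (N + 1) t := fun t => rfl
    rw [R x, R y]
    generalize heckeFactor u (N + 1) = p at *
    generalize heckeFactor u (N + 1 + 1) = q at *
    generalize reflectionOp u (N + 1) = r at *
    replace c1 : q y * r x = r x * q y := c1
    replace c2 : q x * r y = r y * q x := c2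
    change p x * q w * p y = q y * p w * q x at Y1
    change p y * q x * p z = q z * p x * q y at Y2
    change p z * q x * p y = q y * p x * q z at Y3
    change p y * q w * p x = q x * p w * q y at Y4
    -- Yang–Baxter moves and the commutation of q with r push the q's outwards until the bracket p z
    -- · r x · p w · r y of the smaller rank is exposed; after the induction hypothesis reverses it,
    -- the moves are run backwards.
    calc q z * (p x * r x * p x) * q w * (p y * r y * p y)
        = q z * p x * r x * (p x * q w * p y) * r y * p y := by noncomm_ring
      _ = q z * p x * (r x * q y) * p w * (q x * r y) * p y := by rw [Y1]; noncomm_ring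
      _ = (q z * p x * q y) * r x * p w * r y * q x * p y := by rw [← c1, c2]; noncomm_ring
      _ = p y * q x * (p z * r x * p w * r y) * q x * p y := by rw [← Y2]; noncomm_ring
      _ = p y * (q x * r y) * p w * r x * (p z * q x * p y) := by rw [ih]; noncomm_ring
      _ = p y * r y * q x * p w * (r x * q y) * p x * q z := by rw [Y3, c2]; noncomm_ring
      _ = p y * r y * (q x * p w * q y) * r x * p x * q z := by rw [← c1]; noncomm_ring
      _ = p y * r y * p y * q w * (p x * r x * p x) * q z := by rw [← Y4]; noncomm_ring

/-- Solving z ⊕ y = x splits the factor at x as a product of the factors at z and y, which exposes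
one side of the reflection equation. The condition on y is what makes the difference z exist. -/
theorem reflectionOp_comm (hu : HeckeGenerators b u) {x y : ℝ} (hy : 1 + b * y ≠ 0) :
    ∀ N, reflectionOp u N x * reflectionOp u N y = reflectionOp u N y * reflectionOp u N x
  | 0 => rfl
  | 1 => by
    simp only [reflectionOp]
    rw [heckeFactor_mul hu, heckeFactor_mul hu]; congr 1; ring
  | N + 2 => by
    obtain ⟨z, hz⟩ : ∃ z, z + y + b * z * y = x := ⟨(x - y) / (1 + b * y), by
      linear_combination div_mul_cancel₀ (x - y) hy⟩
    have E := reflection_equation hu hz N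
    have M := heckeFactor_mul hu (N + 1)
    have h1 : heckeFactor u (N + 1) x = heckeFactor u (N + 1) y * heckeFactor u (N + 1) z := by
      rw [M]; congr 1; rw [← hz]; ring
    have h2 : heckeFactor u (N + 1) x = heckeFactor u (N + 1) z * heckeFactor u (N + 1) y := by
      rw [M, hz]
    have h3 := M x y
    have h4 := M y x
    have h5 : y + x + b * y * x = x + y + b * x * y := by ring
    rw [h5] at h4
    simp only [reflectionOp]
    set w := x + y + b * x * y
    generalize heckeFactor u (N + 1) = p at *
    generalize reflectionOp u (N + 1) = r at *
    calc p x * r x * p x * (p y * r y * p y)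
        = p x * r x * (p x * p y) * r y * p y := by noncomm_ring
      _ = p y * (p z * r x * p w * r y) * p y := by rw [h3, h1]; noncomm_ring
      _ = p y * r y * p w * r x * (p z * p y) := by rw [E]; noncomm_ring
      _ = p y * r y * (p y * p x) * r x * p x := by rw [h4, ← h2]
      _ = p y * r y * p y * (p x * r x * p x) := by noncomm_ring

theorem reflectionOp_mul_inverse (hu : HeckeGenerators b u) {x y : ℝ} (hxy : x + y + b * x * y = 0) :
    ∀ N, reflectionOp u N x * reflectionOp u N y = 1
  | 0 => by simp [reflectionOp]
  | 1 => by
    simp only [reflectionOp, heckeFactor_mul hu, hxy]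
    simp [heckeFactor]
  | N + 2 => by
    have ih := reflectionOp_mul_inverse hu hxy (N + 1)
    have M : heckeFactor u (N + 1) x * heckeFactor u (N + 1) y = 1 := by
      rw [heckeFactor_mul hu, hxy]
      simp [heckeFactor]
    simp only [reflectionOp]
    generalize heckeFactor u (N + 1) = p at *
    generalize reflectionOp u (N + 1) = r at *
    calc p x * r x * p x * (p y * r y * p y)
        = p x * (r x * (p x * p y) * r y) * p y := by noncomm_ring
      _ = 1 := by rw [M, mul_one, ih, mul_one, M]

/-- This controls the degree in x. Conjugating by a factor would naively raise the degree by two,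
but the quadratic term carries u R u, which collapses to the operator of rank one lower because the
words u_{c+1} u_c u_{c+1} vanish. Hence the palindrome of rank N has degree at most N instead of 2N
- 1. -/
theorem generator_mul_reflectionOp_mul (hu : HeckeGenerators b u) (x : ℝ) :
    ∀ N, u (N + 1) * reflectionOp u (N + 1) x * u (N + 1) =
      b • (u (N + 1) * reflectionOp u N x)
  | 0 => by
    simp only [reflectionOp, heckeFactor, zero_add, mul_add, add_mul, mul_one, hu.sq,
      mul_smul_comm, smul_mul_assoc, hu.up 0, smul_zero, add_zero]
  | N + 1 => by
    have ih := generator_mul_reflectionOp_mul hu x N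
    have c1 := generator_comm_reflectionOp hu (N + 1) (N + 2) x le_rfl
    have c2 := generator_comm_reflectionOp hu N (N + 2) x (by omega)
    have s := hu.sq (N + 2)
    have z := hu.up (N + 1)
    have R : reflectionOp u (N + 2) x =
      heckeFactor u (N + 1) x * reflectionOp u (N + 1) x * heckeFactor u (N + 1) x := rfl
    change u (N + 2) * reflectionOp u (N + 2) x * u (N + 2) = b • (u (N + 2) * reflectionOp u (N + 1) x)
    change u (N + 2) * u (N + 1) * u (N + 2) = 0 at z
    replace c1 : u (N + 2) * reflectionOp u (N + 1) x = reflectionOp u (N + 1) x * u (N + 2) := c1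
    replace c2 : u (N + 2) * reflectionOp u N x = reflectionOp u N x * u (N + 2) := c2
    rw [R]
    simp only [heckeFactor]
    generalize u (N + 2) = a at *
    generalize u (N + 1) = v at *
    generalize reflectionOp u (N + 1) x = r at *
    generalize reflectionOp u N x = t at *
    have e1 : a * v * r * a = 0 := by rw [mul_assoc, ← c1, ← mul_assoc, z, zero_mul]
    have e2 : a * r * v * a = 0 := by rw [c1, mul_assoc r, mul_assoc r, z, mul_zero]
    have e3 : a * (v * r * v) * a = 0 := by
      rw [ih, mul_smul_comm, smul_mul_assoc, ← mul_assoc, mul_assoc, ← c2, ← mul_assoc, z, zero_mul,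
        smul_zero]
    have e4 : a * r * a = b • (a * r) := by
      rw [c1, mul_assoc, s, mul_smul_comm]
    calc a * ((1 + x • v) * r * (1 + x • v)) * a
        = a * r * a + x • (a * v * r * a) + x • (a * r * v * a)
            + (x * x) • (a * (v * r * v) * a) := by
          simp only [mul_add, add_mul, one_mul, mul_one, smul_mul_assoc, mul_smul_comm, mul_assoc]
          module
      _ = b • (a * r) := by rw [e1, e2, e3, e4]; simp

theorem reflectionOp_zero (N : ℕ) : reflectionOp u N 0 = 1 := by
  induction N using Nat.twoStepInduction with
  | zero => rfl
  | one => simp [reflectionOp, heckeFactor]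
  | more N _ ih => simp [reflectionOp, heckeFactor, ih]

theorem reflectionOp_eq_sum (hu : HeckeGenerators b u) :
    ∀ N, ∃ C : ℕ → A, ∀ x, reflectionOp u N x = ∑ i ∈ range (N + 1), x ^ i • C i
  | 0 => ⟨fun _ => 1, fun x => by simp [reflectionOp]⟩
  | 1 => ⟨fun i => if i = 0 then 1 else u 0, fun x => by
      simp [reflectionOp, heckeFactor, sum_range_succ]⟩
  | N + 2 => by
    obtain ⟨C, hC⟩ := reflectionOp_eq_sum hu (N + 1)
    obtain ⟨D, hD⟩ := reflectionOp_eq_sum hu N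
    set a := u (N + 1)
    -- The three groups are the coefficients of R, of x(aR + Ra), and of x² b a R', where R and R'
    -- are the operators of ranks N + 1 and N.
    refine ⟨fun i => (if i ≤ N + 1 then C i else 0) + (if i = 0 then 0 else a * C (i - 1) + C (i - 1) * a) +
      (if i < 2 then 0 else b • (a * D (i - 2))), fun x => ?_⟩
    have e := generator_mul_reflectionOp_mul hu x N
    have e' : reflectionOp u (N + 2) x = reflectionOp u (N + 1) x +
        x • (a * reflectionOp u (N + 1) x + reflectionOp u (N + 1) x * a) +
        x ^ 2 • (b • (a * reflectionOp u N x)) := by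
      rw [← e]
      simp only [reflectionOp, heckeFactor, mul_add, add_mul, one_mul, mul_one, smul_mul_assoc,
        mul_smul_comm]
      module
    rw [e', hC, hD]
    simp only [smul_add, sum_add_distrib]
    congr 1
    · congr 1
      · rw [sum_range_succ _ (N + 1 + 1)]
        simp only [show ¬ (N + 1 + 1 ≤ N + 1) by omega, if_false, smul_zero, add_zero]
        refine sum_congr rfl fun i hi => ?_
        rw [if_pos (by simp at hi; omega)]
      · rw [sum_range_succ' _ (N + 1 + 1)]
        simp [mul_sum, sum_mul, smul_sum, smul_smul, pow_succ', smul_add, sum_add_distrib]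
    · rw [sum_range_succ' _ (N + 1 + 1), sum_range_succ' _ (N + 1)]
      simp [mul_sum, smul_sum, smul_smul, pow_succ']
      refine sum_congr rfl fun i hi => ?_
      congr 1; ring

end Hecke

/-! ### Operators removing boxes from shifted shapes

A shifted shape is recorded by its diagonal lengths `d`: the box in row `i` on the `c`-th
diagonal belongs to the shape when `i < d c`. -/

/-- The last box on the `c`-th diagonal can be removed. -/
def IsRemovable (d : ℕ → ℕ) (c : ℕ) : Prop :=
  d c = d (c + 1) + 1 ∧ (c = 0 ∨ d (c - 1) = d c)

/-- The shape without the last box on the `c`-th diagonal. -/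
def removeBox (d : ℕ → ℕ) (c : ℕ) : ℕ → ℕ := Function.update d c (d c - 1)

theorem removeBox_same (d : ℕ → ℕ) (c : ℕ) : removeBox d c c = d c - 1 := by simp [removeBox]

theorem removeBox_of_ne {d : ℕ → ℕ} {c e : ℕ} (h : e ≠ c) : removeBox d c e = d e := by
  simp [removeBox, h]

open Classical in
/-- The operator `U_c` on functions of shapes. -/
def removalOp (b : ℝ) (c : ℕ) : Module.End ℝ ((ℕ → ℕ) → ℝ) where
  toFun f d := if IsRemovable d c then f (removeBox d c) + b * f d else 0
  map_add' f g := by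
    ext d; by_cases h : IsRemovable d c <;> simp [h]; ring
  map_smul' t f := by
    ext d; by_cases h : IsRemovable d c <;> simp [h]; ring

theorem removalOp_of_removable {b : ℝ} {c : ℕ} {d : ℕ → ℕ} (h : IsRemovable d c)
    (f : (ℕ → ℕ) → ℝ) : removalOp b c f d = f (removeBox d c) + b * f d := by
  simp [removalOp, h]

theorem removalOp_of_not_removable {b : ℝ} {c : ℕ} {d : ℕ → ℕ} (h : ¬ IsRemovable d c)
    (f : (ℕ → ℕ) → ℝ) : removalOp b c f d = 0 := by
  simp [removalOp, h]

theorem not_isRemovable_removeBox {d : ℕ → ℕ} {c : ℕ} (h : IsRemovable d c) :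
    ¬ IsRemovable (removeBox d c) c := by
  intro h'
  have h1 := h.1
  have h2 := h'.1
  rw [removeBox_same, removeBox_of_ne (by omega)] at h2
  omega

/-- The leftmost operator acts on the shape first. If it keeps the box of diagonal c, then e is
blocked by `h0`; if it removes it, the last operator finds nothing to remove on diagonal c, whether
or not e was removed. -/
theorem removalOp_triple_eq_zero {b : ℝ} {c e : ℕ}
    (h0 : ∀ d, IsRemovable d c → ¬ IsRemovable d e)
    (h1 : ∀ d, IsRemovable d c → IsRemovable (removeBox d c) e →
      ¬ IsRemovable (removeBox (removeBox d c) e) c) :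
    removalOp b c * removalOp b e * removalOp b c = 0 := by
  ext f d
  simp only [Module.End.mul_apply, LinearMap.zero_apply, Pi.zero_apply]
  by_cases h : IsRemovable d c
  · rw [removalOp_of_removable h, removalOp_of_not_removable (h0 d h)]
    by_cases h' : IsRemovable (removeBox d c) e
    · rw [removalOp_of_removable h', removalOp_of_not_removable (h1 d h h'),
        removalOp_of_not_removable (not_isRemovable_removeBox h)]
      ring
    · rw [removalOp_of_not_removable h']; ring
  · rw [removalOp_of_not_removable h]

theorem isRemovable_removeBox_iff {d : ℕ → ℕ} {c e : ℕ} (h : c + 2 ≤ e ∨ e + 2 ≤ c) :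
    IsRemovable (removeBox d c) e ↔ IsRemovable d e := by
  have h1 : removeBox d c e = d e := removeBox_of_ne (by omega)
  have h2 : removeBox d c (e + 1) = d (e + 1) := removeBox_of_ne (by omega)
  rcases Nat.eq_zero_or_pos e with rfl | he
  · simp [IsRemovable, h1, h2]
  · have h3 : removeBox d c (e - 1) = d (e - 1) := removeBox_of_ne (by omega)
    simp [IsRemovable, h1, h2, h3]

/-- Two successive boxes of a diagonal c ≥ 1 are separated by boxes on both neighbouring diagonals,
so one intermediate removal cannot free the second. The main diagonal has a single neighbour, which
is why U₀U₁U₀ is not required to vanish. -/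
theorem removalOp_heckeGenerators (b : ℝ) : HeckeGenerators b (removalOp b) where
  sq c := by
    ext f d
    simp only [Module.End.mul_apply, LinearMap.smul_apply, Pi.smul_apply, smul_eq_mul]
    by_cases h : IsRemovable d c
    · rw [removalOp_of_removable h,
        removalOp_of_not_removable (not_isRemovable_removeBox h), zero_add]
    · rw [removalOp_of_not_removable h, removalOp_of_not_removable h, mul_zero]
  comm c e h := by
    ext f d
    have hc := isRemovable_removeBox_iff (d := d) (c := c) (e := e) (by omega)
    have he := isRemovable_removeBox_iff (d := d) (c := e) (e := c) (by omega)
    have hcomm : removeBox (removeBox d c) e = removeBox (removeBox d e) c := by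
      unfold removeBox
      rw [Function.update_of_ne (by omega), Function.update_of_ne (by omega),
        Function.update_comm (by omega)]
    simp only [Module.End.mul_apply]
    by_cases h1 : IsRemovable d c <;> by_cases h2 : IsRemovable d e
    · rw [removalOp_of_removable h1 (removalOp b e f), removalOp_of_removable h2 f,
        removalOp_of_removable h2 (removalOp b c f), removalOp_of_removable h1 f, removalOp_of_removable (hc.2 h2),
        removalOp_of_removable (he.2 h1), hcomm]
      ring
    · rw [removalOp_of_removable h1, removalOp_of_not_removable h2, removalOp_of_not_removable h2,
        removalOp_of_not_removable (mt hc.1 h2)]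
      ring
    · rw [removalOp_of_removable h2, removalOp_of_not_removable h1, removalOp_of_not_removable h1,
        removalOp_of_not_removable (mt he.1 h1)]
      ring
    · rw [removalOp_of_not_removable h1, removalOp_of_not_removable h2]
  up c := by
    refine removalOp_triple_eq_zero ?_ ?_
    · intro d h h'
      have := h.2; have := h'.1
      simp at *; omega
    · intro d h h' h''
      have e1 := h.1; have e2 := h''.1
      simp (disch := omega) only [removeBox_same, removeBox_of_ne] at e2
      omega
  down c := by
    refine removalOp_triple_eq_zero ?_ ?_
    · intro d h h'
      have h1 : d (c + 1) = d (c + 2) + 1 := h.1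
      have h2 := h'.2
      simp only [show c + 2 - 1 = c + 1 by omega] at h2
      omega
    · intro d h h' h''
      have e1 := h.1; have e2 := h.2; have e3 := h''.2
      simp (disch := omega) only [removeBox_same, removeBox_of_ne, Nat.add_sub_cancel] at e2 e3
      omega

/-- Diagonal lengths of the shifted staircase with rows `r, r-1, …, 1`. -/
def stair (r : ℕ) : ℕ → ℕ := fun c => r - c

open Classical in
/-- The indicator function of the empty shape. -/
def vacuum : (ℕ → ℕ) → ℝ := fun d => if d = 0 then 1 else 0

/-- The generating function of set-valued shifted tableaux of staircase shape, in operator form. -/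
def stairSum (b : ℝ) (r : ℕ) (xs : List ℝ) : ℝ :=
  (xs.map (reflectionOp (removalOp b) r)).prod vacuum (stair r)

/-! #### Locality -/

theorem reflectionOp_apply_induction {P : ((ℕ → ℕ) → ℝ) → ((ℕ → ℕ) → ℝ) → Prop} {b : ℝ} (N : ℕ) (x : ℝ)
    (h : ∀ c < N, ∀ f g, P f g → P (heckeFactor (removalOp b) c x f) (heckeFactor (removalOp b) c x g))
    {f g : (ℕ → ℕ) → ℝ} (hfg : P f g) :
    P (reflectionOp (removalOp b) N x f) (reflectionOp (removalOp b) N x g) := by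
  induction N using Nat.twoStepInduction generalizing f g with
  | zero => exact hfg
  | one => exact h 0 (by omega) _ _ hfg
  | more N _ ih =>
    exact h _ (by omega) _ _ (ih (fun c hc => h c (by omega)) (h _ (by omega) _ _ hfg))

theorem heckeFactor_apply (b : ℝ) (c : ℕ) (x : ℝ) (f : (ℕ → ℕ) → ℝ) (d : ℕ → ℕ) :
    heckeFactor (removalOp b) c x f d = f d + x * removalOp b c f d := by
  simp [heckeFactor]

/-- `f` and `g` agree on shapes with no boxes on the `r`-th diagonal. -/
def AgreeBelow (r : ℕ) (f g : (ℕ → ℕ) → ℝ) : Prop := ∀ d : ℕ → ℕ, d r = 0 → f d = g d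

theorem heckeFactor_agreeBelow {b : ℝ} {r c : ℕ} (x : ℝ) {f g : (ℕ → ℕ) → ℝ}
    (h : AgreeBelow r f g) :
    AgreeBelow r (heckeFactor (removalOp b) c x f) (heckeFactor (removalOp b) c x g) := by
  intro d hd
  rw [heckeFactor_apply, heckeFactor_apply, h d hd]
  by_cases hc : IsRemovable d c
  · have : c ≠ r := by rintro rfl; have := hc.1; omega
    rw [removalOp_of_removable hc, removalOp_of_removable hc, h d hd,
      h _ (by rw [removeBox_of_ne this.symm]; exact hd)]
  · rw [removalOp_of_not_removable hc, removalOp_of_not_removable hc]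

theorem heckeFactor_top_agreeBelow {b : ℝ} {r : ℕ} (x : ℝ) (f : (ℕ → ℕ) → ℝ) :
    AgreeBelow r (heckeFactor (removalOp b) r x f) f := by
  intro d hd
  rw [heckeFactor_apply, removalOp_of_not_removable (by intro h; have := h.1; omega)]
  ring

theorem AgreeBelow.trans {r : ℕ} {f g k : (ℕ → ℕ) → ℝ} (h : AgreeBelow r f g)
    (h' : AgreeBelow r g k) : AgreeBelow r f k := fun d hd => (h d hd).trans (h' d hd)

theorem reflectionOp_succ_agreeBelow {b : ℝ} (r : ℕ) (x : ℝ) {f g : (ℕ → ℕ) → ℝ}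
    (h : AgreeBelow r f g) :
    AgreeBelow r (reflectionOp (removalOp b) (r + 1) x f) (reflectionOp (removalOp b) r x g) := by
  rcases r with _ | r
  · exact (heckeFactor_top_agreeBelow x f).trans h
  · refine (heckeFactor_top_agreeBelow x _).trans ?_
    refine reflectionOp_apply_induction (P := AgreeBelow (r + 1)) _ _
      (fun c _ f g hfg => heckeFactor_agreeBelow x hfg) ?_
    exact (heckeFactor_top_agreeBelow x f).trans h

/-- The extra outer factors live on diagonal r, which is empty in this staircase and in everything
obtained from it by removals. -/
theorem prod_reflectionOp_stair (b : ℝ) (r : ℕ) (xs : List ℝ) :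
    (xs.map (reflectionOp (removalOp b) (r + 1))).prod vacuum (stair r) = stairSum b r xs := by
  have : AgreeBelow r ((xs.map (reflectionOp (removalOp b) (r + 1))).prod vacuum)
      ((xs.map (reflectionOp (removalOp b) r)).prod vacuum) := by
    induction xs with
    | nil => intro d _; rfl
    | cons x xs ih =>
      simp only [List.map_cons, List.prod_cons, Module.End.mul_apply]
      exact reflectionOp_succ_agreeBelow r x ih
  exact this _ (by simp [stair])

/-! #### Too few variables -/

/-- `f` vanishes on shapes with more than `n` rows. -/
def VanishAbove (n : ℕ) (f : (ℕ → ℕ) → ℝ) : Prop := ∀ d : ℕ → ℕ, n < d 0 → f d = 0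

theorem heckeFactor_vanishAbove {b : ℝ} {n c : ℕ} (hc : c ≠ 0) (x : ℝ) {f : (ℕ → ℕ) → ℝ}
    (h : VanishAbove n f) : VanishAbove n (heckeFactor (removalOp b) c x f) := by
  intro d hd
  rw [heckeFactor_apply, h d hd]
  by_cases hr : IsRemovable d c
  · rw [removalOp_of_removable hr, h d hd, h _ (by rwa [removeBox_of_ne hc.symm])]; ring
  · rw [removalOp_of_not_removable hr]; ring

theorem heckeFactor_zero_vanishAbove {b : ℝ} {n : ℕ} (x : ℝ) {f : (ℕ → ℕ) → ℝ}
    (h : VanishAbove n f) : VanishAbove (n + 1) (heckeFactor (removalOp b) 0 x f) := by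
  intro d hd
  rw [heckeFactor_apply, h d (by omega)]
  by_cases hr : IsRemovable d 0
  · rw [removalOp_of_removable hr, h d (by omega), h _ (by rw [removeBox_same]; omega)]; ring
  · rw [removalOp_of_not_removable hr]; ring

theorem reflectionOp_vanishAbove {b : ℝ} (N n : ℕ) (x : ℝ) {f : (ℕ → ℕ) → ℝ}
    (h : VanishAbove n f) : VanishAbove (n + 1) (reflectionOp (removalOp b) N x f) := by
  induction N using Nat.twoStepInduction generalizing f with
  | zero => exact fun d hd => h d (by omega)
  | one => exact heckeFactor_zero_vanishAbove x h
  | more N _ ih =>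
    exact heckeFactor_vanishAbove (by omega) x (ih (heckeFactor_vanishAbove (by omega) x h))

/-- The length of the main diagonal is the number of rows, and each palindrome contains the factor
of diagonal 0 at most once, so each variable accounts for at most one row. -/
theorem stairSum_eq_zero {b : ℝ} {r : ℕ} {xs : List ℝ} (h : xs.length < r) :
    stairSum b r xs = 0 := by
  have : VanishAbove xs.length ((xs.map (reflectionOp (removalOp b) r)).prod vacuum) := by
    clear h
    induction xs with
    | nil =>
      intro d hd
      have : d ≠ 0 := by rintro rfl; simp at hd
      simp [vacuum, this]
    | cons x xs ih => exact reflectionOp_vanishAbove r _ x ih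
  exact this _ (by simpa [stair] using h)

/-! #### The value at `-1/b` -/

theorem heckeFactor_pole_of_removable {b : ℝ} (hb : b ≠ 0) {c : ℕ} {d : ℕ → ℕ}
    (h : IsRemovable d c) (f : (ℕ → ℕ) → ℝ) :
    heckeFactor (removalOp b) c (-b⁻¹) f d = -b⁻¹ * f (removeBox d c) := by
  rw [heckeFactor_apply, removalOp_of_removable h]; field_simp; ring

theorem heckeFactor_of_not_removable {b x : ℝ} {c : ℕ} {d : ℕ → ℕ}
    (h : ¬ IsRemovable d c) (f : (ℕ → ℕ) → ℝ) :
    heckeFactor (removalOp b) c x f d = f d := by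
  rw [heckeFactor_apply, removalOp_of_not_removable h, mul_zero, add_zero]

/-- At x = -1/b the term keeping a removable box cancels, so the removal is forced. On the staircase
the left factors of diagonals c ≥ 1 find nothing to remove; diagonal 0 loses its corner, and each
right factor then removes the box just exposed. For N = r + 1 this strips the last column. -/
theorem reflectionOp_pole {b : ℝ} (hb : b ≠ 0) (r : ℕ) :
    ∀ N ≤ r + 1, ∀ f : (ℕ → ℕ) → ℝ, reflectionOp (removalOp b) N (-b⁻¹) f (stair (r + 1)) =
      (-b⁻¹) ^ N * f (fun c => if c < N then r - c else r + 1 - c)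
  | 0, _, f => by simp [reflectionOp]; rfl
  | 1, _, f => by
    have h : IsRemovable (stair (r + 1)) 0 := by simp [IsRemovable, stair]
    rw [reflectionOp, heckeFactor_pole_of_removable hb h, pow_one]
    congr 2
    ext c
    rcases c with _ | c
    · simp [removeBox_same, stair]
    · simp [removeBox_of_ne, stair]
  | N + 2, hN, f => by
    have h0 : ¬ IsRemovable (stair (r + 1)) (N + 1) := by
      intro h; have := h.2; simp [stair] at this; omega
    have h : IsRemovable (fun c => if c < N + 1 then r - c else r + 1 - c) (N + 1) := by
      simp [IsRemovable]; omega
    rw [reflectionOp, Module.End.mul_apply, Module.End.mul_apply, heckeFactor_of_not_removable h0,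
      reflectionOp_pole hb r (N + 1) (by omega), heckeFactor_pole_of_removable hb h, ← mul_assoc,
      ← pow_succ]
    congr 2
    ext c
    by_cases hc : c = N + 1
    · subst hc; rw [removeBox_same]; simp; omega
    · rw [removeBox_of_ne hc]
      by_cases h' : c < N + 1
      · simp [h', show c < N + 2 by omega]
      · simp [h', show ¬ c < N + 2 by omega]

theorem stairSum_pole {b : ℝ} (hb : b ≠ 0) (r : ℕ) (xs : List ℝ) :
    stairSum b (r + 1) (-b⁻¹ :: xs) = (-b⁻¹) ^ (r + 1) * stairSum b r xs := by
  rw [stairSum, List.map_cons, List.prod_cons, Module.End.mul_apply,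
    reflectionOp_pole hb r (r + 1) le_rfl, ← prod_reflectionOp_stair]
  congr 1
  refine congrArg _ (funext fun c => ?_)
  by_cases hc : c < r + 1
  · simp [hc, stair]
  · simp [hc, stair]; omega

/-! #### Symmetry and cancellation -/

/-- Only the tail is permuted, so nothing is required of the head, which is the variable of the
interpolation. -/
theorem stairSum_perm {b : ℝ} (r : ℕ) (x : ℝ) {xs ys : List ℝ} (h : xs.Perm ys)
    (hx : ∀ y ∈ xs, 1 + b * y ≠ 0) : stairSum b r (x :: xs) = stairSum b r (x :: ys) := by
  have : (xs.map (reflectionOp (removalOp b) r)).prod =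
      (ys.map (reflectionOp (removalOp b) r)).prod := by
    refine (h.map _).prod_eq' ?_
    rw [List.pairwise_map]
    exact List.pairwise_of_forall_mem_list fun y hy z hz =>
      reflectionOp_comm (removalOp_heckeGenerators b) (hx z hz) r
  simp only [stairSum, List.map_cons, List.prod_cons, this]

theorem stairSum_cancel {b x y : ℝ} (r : ℕ) (hxy : x + y + b * x * y = 0) (xs : List ℝ) :
    stairSum b r (x :: y :: xs) = stairSum b r xs := by
  simp only [stairSum, List.map_cons, List.prod_cons, ← mul_assoc,
    reflectionOp_mul_inverse (removalOp_heckeGenerators b) hxy r, one_mul]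

/-- `stairSum` is a polynomial of degree `r` in each variable. -/
theorem exists_stairSum_eq_sum (b : ℝ) (r : ℕ) (xs : List ℝ) : ∃ C : ℕ → ℝ,
    C 0 = stairSum b r (0 :: xs) ∧
      ∀ x, stairSum b r (x :: xs) = ∑ i ∈ range (r + 1), x ^ i * C i := by
  obtain ⟨C, hC⟩ := reflectionOp_eq_sum (removalOp_heckeGenerators b) r
  have key : ∀ x, stairSum b r (x :: xs) = ∑ i ∈ range (r + 1), x ^ i *
      C i ((xs.map (reflectionOp (removalOp b) r)).prod vacuum) (stair r) := fun x => by
    rw [stairSum, List.map_cons, List.prod_cons, Module.End.mul_apply, hC]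
    simp
  refine ⟨_, ?_, key⟩
  rw [key, sum_range_succ']
  simp

theorem stairSum_zero_cons (b : ℝ) (r : ℕ) (xs : List ℝ) :
    stairSum b r (0 :: xs) = stairSum b r xs := by
  simp [stairSum, reflectionOp_zero]

theorem stairSum_zero (b : ℝ) (xs : List ℝ) : stairSum b 0 xs = 1 := by
  induction xs with
  | nil =>
    have : stair 0 = 0 := by ext; simp [stair]
    simp [stairSum, vacuum, this]
  | cons x xs ih => simpa [stairSum, reflectionOp] using ih

/-! ### The staircase determinant -/

/-- The entries `(w (w - b))^{min(j, r)} w^{j - r}` of the staircase determinant. -/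
def stairEntry (b : ℝ) (r j : ℕ) (w : ℝ) : ℝ := (w * (w - b)) ^ min j r * w ^ (j - r)

/-- The determinant of the staircase Grothendieck polynomial, in the variables `w = b + 1/x`. -/
def stairDet (b : ℝ) (r : ℕ) {n : ℕ} (w : Fin n → ℝ) : ℝ :=
  (Matrix.of fun i j : Fin n => stairEntry b r j (w i)).det

/-- The Vandermonde determinant. -/
def vdm {n : ℕ} (w : Fin n → ℝ) : ℝ := (Matrix.vandermonde w).det

theorem vdm_cons {n : ℕ} (t : ℝ) (w : Fin n → ℝ) :
    vdm (Fin.cons t w : Fin (n + 1) → ℝ) = (∏ i, (w i - t)) * vdm w := by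
  simp only [vdm, Matrix.det_vandermonde, Fin.prod_univ_succ, Fin.prod_Ioi_zero, Fin.prod_Ioi_succ,
    Fin.cons_succ, Fin.cons_zero]

theorem stairDet_perm (b : ℝ) (r : ℕ) {n : ℕ} (w : Fin n → ℝ) (σ : Equiv.Perm (Fin n)) :
    stairDet b r (w ∘ σ) = Equiv.Perm.sign σ * stairDet b r w := by
  rw [stairDet, stairDet, ← Matrix.det_permute]; rfl

theorem vdm_perm {n : ℕ} (w : Fin n → ℝ) (σ : Equiv.Perm (Fin n)) :
    vdm (w ∘ σ) = Equiv.Perm.sign σ * vdm w := by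
  rw [vdm, vdm, ← Matrix.det_permute]; rfl

theorem stairDet_eq_zero {b : ℝ} {r n : ℕ} {w : Fin n → ℝ} {i j : Fin n} (hij : i ≠ j)
    (h : ∀ k < n, stairEntry b r k (w i) = stairEntry b r k (w j)) : stairDet b r w = 0 :=
  Matrix.det_zero_of_row_eq hij (funext fun k => h k k.2)

theorem stairDet_rank_zero (b : ℝ) {n : ℕ} (w : Fin n → ℝ) : stairDet b 0 w = vdm w := by
  unfold stairDet vdm
  congr 1
  ext i j
  simp [stairEntry]

/-- Since the rank is positive, the row at w = 0 is (1, 0, …, 0); deleting column 0 shifts column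
index and rank together and leaves a factor w(w - b) in every row. This matches `stairSum_pole`, as
w = 0 means x = -1/b. -/
theorem stairDet_cons_zero (b : ℝ) (r : ℕ) {n : ℕ} (w : Fin n → ℝ) :
    stairDet b (r + 1) (Fin.cons 0 w : Fin (n + 1) → ℝ) =
      (∏ i, w i * (w i - b)) * stairDet b r w := by
  rw [stairDet, Matrix.det_succ_row_zero, Fin.sum_univ_succ, Finset.sum_eq_zero, add_zero, stairDet,
    ← Matrix.det_mul_column]
  · simp only [Matrix.of_apply, Fin.cons_zero]
    simp only [stairEntry, Fin.val_zero, pow_zero, Nat.zero_min, Nat.zero_sub, mul_one, one_mul]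
    congr 1
    ext i j
    simp only [Matrix.submatrix_apply, Matrix.of_apply, Fin.cons_succ,
      Fin.succAbove_zero, Fin.val_succ, Nat.add_sub_add_right, Nat.add_min_add_right, pow_succ]
    ring
  · intro j _
    simp [stairEntry]

/-- The columns of the staircase determinant after column operations adapted to `v`. -/
def reducedEntry (b : ℝ) (r : ℕ) (v : ℝ) (j : ℕ) (w : ℝ) : ℝ :=
  if j = 0 then 1
  else if j ≤ r then (w * (w - b) - v) * stairEntry b r (j - 1) w
  else if j = r + 1 then stairEntry b r (r + 1) w
  else (w * (w - b) - v) * stairEntry b r (j - 2) w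

theorem sum_mul_ite_add_eq {N : ℕ} (f : ℕ → ℝ) (c : ℕ) (j : ℕ) (hj : j < N) :
    ∑ m : Fin N, f m * (if (m : ℕ) + c = j then 1 else 0) = if c ≤ j then f (j - c) else 0 := by
  rw [Fin.sum_univ_eq_sum_range (fun m => f m * (if m + c = j then 1 else 0)) N]
  split_ifs with h
  · rw [Finset.sum_eq_single (j - c)]
    · simp [h]
    · intro m _ hm; rw [if_neg (by omega), mul_zero]
    · intro h'; simp at h'; omega
  · refine Finset.sum_eq_zero fun m _ => ?_
    rw [if_neg (by omega), mul_zero]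

/-- A unitriangular column operation makes every column except 0 and r + 1 divisible by w(w - b) -
v: column j loses v times column j - 1 for 1 ≤ j ≤ r, and b times column j - 1 plus v times column j
- 2 for j ≥ r + 2. -/
theorem stairDet_eq_det_reducedEntry (b : ℝ) (r : ℕ) (v : ℝ) {n : ℕ} (w : Fin n → ℝ) :
    stairDet b r w = (Matrix.of fun i j : Fin n => reducedEntry b r v j (w i)).det := by
  let α : ℕ → ℝ := fun j => if j ≤ r then -v else if r + 2 ≤ j then -b else 0
  let β : ℕ → ℝ := fun j => if r + 2 ≤ j then -v else 0
  let M : Matrix (Fin n) (Fin n) ℝ := Matrix.of fun m j =>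
    (if (m : ℕ) + 0 = j then 1 else 0) + (if (m : ℕ) + 1 = j then 1 else 0) * α j +
      (if (m : ℕ) + 2 = j then 1 else 0) * β j
  have hM : M.det = 1 := by
    have ht : M.BlockTriangular id := by
      intro i j hij
      have hij' : (j : ℕ) < i := hij
      simp only [M, Matrix.of_apply]
      rw [if_neg (by omega), if_neg (by omega), if_neg (by omega)]
      ring
    rw [Matrix.det_of_isUpperTriangular ht]
    refine Finset.prod_eq_one fun i _ => ?_
    simp [M]
  rw [stairDet, ← mul_one (Matrix.det _), ← hM, ← Matrix.det_mul]
  congr 1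
  ext i j
  simp only [Matrix.mul_apply, M, Matrix.of_apply, mul_add, Finset.sum_add_distrib, ← mul_assoc,
    ← Finset.sum_mul]
  set x := w i
  rw [sum_mul_ite_add_eq (fun m => stairEntry b r m x) 0 j j.2,
    sum_mul_ite_add_eq (fun m => stairEntry b r m x) 1 j j.2,
    sum_mul_ite_add_eq (fun m => stairEntry b r m x) 2 j j.2]
  obtain ⟨j, hj⟩ := j
  simp only [reducedEntry, α, β, Nat.zero_le, if_true, Nat.sub_zero]
  rcases Nat.eq_zero_or_pos j with rfl | h0
  · simp [stairEntry]
  obtain ⟨j, rfl⟩ : ∃ k, j = k + 1 := ⟨j - 1, by omega⟩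
  rw [if_neg (Nat.succ_ne_zero j)]
  rcases lt_trichotomy j r with h1 | h1 | h1
  · have e1 : min (j + 1) r = j + 1 := by omega
    have e2 : min j r = j := by omega
    have e3 : j + 1 - r = 0 := by omega
    have e4 : j - r = 0 := by omega
    simp [show j + 1 ≤ r by omega, show ¬ r + 2 ≤ j + 1 by omega, stairEntry, e2, e3, e4]
    ring
  · subst h1; simp
  · obtain ⟨k, rfl⟩ : ∃ k, j = r + 1 + k := ⟨j - (r + 1), by omega⟩
    have e1 : min (r + 1 + k + 1) r = r := by omega
    have e2 : min (r + 1 + k) r = r := by omega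
    have e3 : r + 1 + k + 1 - r = k + 2 := by omega
    have e4 : r + 1 + k - r = k + 1 := by omega
    have e5 : r + 1 + k + 1 - 2 = r + k := by omega
    have e6 : min (r + k) r = r := by omega
    have e7 : r + k - r = k := by omega
    have p1 : ¬ r + 1 + k + 1 ≤ r := by omega
    have p2 : r + 2 ≤ r + 1 + k + 1 := by omega
    have p3 : ¬ r + 1 + k + 1 = r + 1 := by omega
    have p4 : 1 ≤ r + 1 + k + 1 := by omega
    have p5 : 2 ≤ r + 1 + k + 1 := by omega
    simp only [if_neg p1, if_pos p2, if_neg p3, if_pos p4, if_pos p5]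
    simp only [stairEntry, e1, e2, e3, e4, e5, e6, e7, Nat.add_sub_cancel]
    ring

theorem reducedEntry_self (b : ℝ) (r j : ℕ) (w : ℝ) (h0 : j ≠ 0) (h : j ≠ r + 1) :
    reducedEntry b r (w * (w - b)) j w = 0 := by
  simp [reducedEntry, h0, h]

/-- The points t and b - t are the two roots of w(w - b) = v, so after reduction their rows live in
columns 0 and r + 1 only, and the complementary minor is the smaller determinant with its rows
rescaled. The bound r ≤ n guarantees that column r + 1 exists. -/
theorem stairDet_cancel (b : ℝ) {r n : ℕ} (h : r ≤ n) (t : ℝ) (w : Fin n → ℝ) :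
    stairDet b r (Fin.cons (b - t) (Fin.cons t w : Fin (n + 1) → ℝ) : Fin (n + 2) → ℝ) =
      (-(t * (t - b))) ^ r * (t - (b - t)) * (∏ i, (w i * (w i - b) - t * (t - b))) *
        stairDet b r w := by
  set v := t * (t - b) with hv
  set W : Fin (n + 2) → ℝ := Fin.cons (b - t) (Fin.cons t w : Fin (n + 1) → ℝ) with hW
  have hW0 : W 0 = b - t := rfl
  have hW1 : W 1 = t := rfl
  have hv' : (b - t) * (b - t - b) = v := by rw [hv]; ring
  rw [stairDet_eq_det_reducedEntry b r v W]
  set Q : Matrix (Fin (n + 2)) (Fin (n + 2)) ℝ :=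
    Matrix.of fun i j : Fin (n + 2) => reducedEntry b r v j (W i) with hQ
  have hr : r + 1 < n + 2 := by omega
  let c : Fin (n + 2) := ⟨r + 1, hr⟩
  have hrow : ∀ j, (Q 0 + (-1 : ℝ) • Q 1) j = if j = c then v ^ r * (b - t - t) else 0 := by
    intro j
    simp only [Pi.add_apply, Pi.smul_apply, smul_eq_mul, hQ, Matrix.of_apply, hW0, hW1]
    by_cases hj : j = c
    · subst hj
      rw [if_pos rfl]
      simp only [c, reducedEntry, stairEntry]
      rw [hv', ← hv]
      simp
      ring
    · rw [if_neg hj]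
      have hj' : (j : ℕ) ≠ r + 1 := fun e => hj (Fin.ext e)
      by_cases h0 : (j : ℕ) = 0
      · simp [reducedEntry, h0]
      · have e1 := reducedEntry_self b r j (b - t) h0 hj'
        have e2 := reducedEntry_self b r j t h0 hj'
        rw [hv'] at e1
        rw [← hv] at e2
        rw [e1, e2]; simp
  -- Subtracting the row of t also clears column 0, where both rows have entry 1.
  rw [← Matrix.det_updateRow_add_smul_self Q (i := 0) (j := 1) (by simp) (-1),
    Matrix.det_succ_row_zero, Finset.sum_eq_single c]
  rotate_left
  · intro j _ hj
    rw [Matrix.updateRow_self, hrow, if_neg hj]; simp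
  · simp
  rw [Matrix.updateRow_self, hrow, if_pos rfl, Matrix.det_succ_row_zero, Finset.sum_eq_single 0]
  rotate_left
  · intro j _ hj
    have hne : c.succAbove j ≠ c := Fin.succAbove_ne c j
    have h0 : c.succAbove j ≠ 0 := by
      rw [Ne, Fin.succAbove_eq_zero_iff]
      · exact hj
      · simp [c, Fin.ext_iff]
    simp only [Matrix.submatrix_apply, Fin.succ_zero_eq_one]
    rw [Matrix.updateRow_ne (by simp)]
    simp only [hQ, Matrix.of_apply, hW1, hv]
    rw [reducedEntry_self b r _ t (fun e => h0 (Fin.ext e)) (fun e => hne (Fin.ext e))]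
    simp
  · simp
  have hc0 : c.succAbove 0 = 0 := Fin.succAbove_ne_zero_zero (by simp [c, Fin.ext_iff])
  have e1 : ((Matrix.updateRow Q 0 (Q 0 + (-1 : ℝ) • Q 1)).submatrix Fin.succ c.succAbove) 0 0 = 1 := by
    simp only [Matrix.submatrix_apply, Fin.succ_zero_eq_one, hc0]
    rw [Matrix.updateRow_ne (by simp)]
    simp [hQ, reducedEntry]
  rw [e1]
  have e2 : (((Matrix.updateRow Q 0 (Q 0 + (-1 : ℝ) • Q 1)).submatrix Fin.succ
      c.succAbove).submatrix Fin.succ (Fin.succAbove 0)).det =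
      (∏ i, (w i * (w i - b) - v)) * stairDet b r w := by
    rw [stairDet, ← Matrix.det_mul_column]
    congr 1
    ext i j
    simp only [Matrix.submatrix_apply, Fin.succAbove_zero]
    rw [Matrix.updateRow_ne (Fin.succ_ne_zero _)]
    have hWi : W i.succ.succ = w i := rfl
    simp only [hQ, Matrix.of_apply, hWi]
    have hlt : c.succAbove j.succ = if (j : ℕ) + 1 < r + 1 then j.succ.castSucc else j.succ.succ := by
      simp [Fin.succAbove, c, Fin.lt_def]
    rw [hlt]
    by_cases hj : (j : ℕ) + 1 < r + 1
    · rw [if_pos hj]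
      simp only [Fin.val_castSucc, Fin.val_succ, reducedEntry]
      rw [if_neg (by omega), if_pos (by omega)]; simp
    · rw [if_neg hj]
      simp only [Fin.val_succ, reducedEntry]
      rw [if_neg (by omega), if_neg (by omega), if_neg (by omega)]; simp
  rw [e2, neg_pow v r]
  simp only [c, Fin.val_zero, pow_succ]
  ring

/-! ### Interpolation in the first variable -/

/-- The polynomial whose values are the staircase entries. -/
def stairPoly (b : ℝ) (r j : ℕ) : Polynomial ℝ :=
  (Polynomial.X * (Polynomial.X - Polynomial.C b)) ^ min j r * Polynomial.X ^ (j - r)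

theorem stairPoly_eval (b : ℝ) (r j : ℕ) (w : ℝ) :
    (stairPoly b r j).eval w = stairEntry b r j w := by
  simp [stairPoly, stairEntry]

theorem stairPoly_natDegree_le (b : ℝ) (r j : ℕ) :
    (stairPoly b r j).natDegree ≤ 2 * j := by
  unfold stairPoly
  refine (Polynomial.natDegree_mul_le).trans ?_
  refine (add_le_add Polynomial.natDegree_pow_le (Polynomial.natDegree_X_pow_le _)).trans ?_
  have : (Polynomial.X * (Polynomial.X - Polynomial.C b)).natDegree ≤ 2 :=
    (Polynomial.natDegree_mul_le).trans (by simp [Polynomial.natDegree_X])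
  have : min j r * (Polynomial.X * (Polynomial.X - Polynomial.C b)).natDegree ≤ min j r * 2 :=
    Nat.mul_le_mul_left _ this
  omega

/-- The tableau side of the determinant formula. -/
def stairRhs (b : ℝ) (r : ℕ) {n : ℕ} (w : Fin n → ℝ) : ℝ :=
  (∏ i, (w i - b)) ^ r * stairSum b r (List.ofFn fun i => (w i - b)⁻¹) * vdm w

theorem stairRhs_cons (b : ℝ) (r : ℕ) {n : ℕ} (t : ℝ) (w : Fin n → ℝ) :
    stairRhs b r (Fin.cons t w : Fin (n + 1) → ℝ) =
      (t - b) ^ r * (∏ i, (w i - b)) ^ r *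
        stairSum b r ((t - b)⁻¹ :: List.ofFn fun i => (w i - b)⁻¹) * ((∏ i, (w i - t)) * vdm w) := by
  rw [stairRhs, Fin.prod_univ_succ, List.ofFn_succ, vdm_cons, mul_pow]
  rfl

theorem cons_comp_swap {n : ℕ} (t : ℝ) (w : Fin n → ℝ) (i j : Fin n) :
    (Fin.cons t (w ∘ Equiv.swap i j) : Fin (n + 1) → ℝ) =
      (Fin.cons t w : Fin (n + 1) → ℝ) ∘ Equiv.swap i.succ j.succ := by
  funext k
  refine Fin.cases ?_ (fun k => ?_) k
  · rw [Function.comp_apply, Equiv.swap_apply_of_ne_of_ne (Fin.succ_ne_zero _).symm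
      (Fin.succ_ne_zero _).symm]
    rfl
  · have : Equiv.swap i.succ j.succ k.succ = (Equiv.swap i j k).succ := by
      simp only [Equiv.swap_apply_def, Fin.succ_inj]
      split_ifs <;> rfl
    rw [Function.comp_apply, this, Fin.cons_succ, Fin.cons_succ]
    rfl

theorem stairRhs_cons_swap {b : ℝ} (hb : 0 < b) (r : ℕ) {n : ℕ} (t : ℝ) {w : Fin n → ℝ}
    (hw : ∀ i, b < w i) (i j : Fin n) (hij : i ≠ j) :
    stairRhs b r (Fin.cons t (w ∘ Equiv.swap i j) : Fin (n + 1) → ℝ) =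
      - stairRhs b r (Fin.cons t w : Fin (n + 1) → ℝ) := by
  rw [stairRhs_cons, stairRhs_cons, vdm_perm, Equiv.Perm.sign_swap hij]
  have hperm : stairSum b r ((t - b)⁻¹ :: List.ofFn fun k => ((w ∘ Equiv.swap i j) k - b)⁻¹) =
      stairSum b r ((t - b)⁻¹ :: List.ofFn fun k => (w k - b)⁻¹) := by
    refine stairSum_perm r _ (Equiv.Perm.ofFn_comp_perm (Equiv.swap i j) fun k => (w k - b)⁻¹) ?_
    intro y hy
    obtain ⟨k, rfl⟩ := (List.mem_ofFn' _ _).1 hy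
    have : 0 < (w (Equiv.swap i j k) - b)⁻¹ := inv_pos.2 (sub_pos.2 (hw _))
    simp only [Function.comp_apply]
    positivity
  rw [hperm]
  have e1 : ∏ k, ((w ∘ Equiv.swap i j) k - b) = ∏ k, (w k - b) :=
    Equiv.prod_comp (Equiv.swap i j) fun k => w k - b
  have e2 : ∏ k, ((w ∘ Equiv.swap i j) k - t) = ∏ k, (w k - t) :=
    Equiv.prod_comp (Equiv.swap i j) fun k => w k - t
  rw [e1, e2]
  simp

theorem stairRhs_cancel {b : ℝ} {r n : ℕ} {t : ℝ} (ht : t ≠ 0) (htb : t ≠ b) (w : Fin n → ℝ) :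
    stairRhs b r (Fin.cons (b - t) (Fin.cons t w : Fin (n + 1) → ℝ) : Fin (n + 2) → ℝ) =
      (-(t * (t - b))) ^ r * (t - (b - t)) * (∏ i, (w i * (w i - b) - t * (t - b))) *
        stairRhs b r w := by
  have htb' := sub_ne_zero.2 htb
  have hl : stairSum b r ((b - t - b)⁻¹ :: List.ofFn fun i =>
      ((Fin.cons t w : Fin (n + 1) → ℝ) i - b)⁻¹) =
      stairSum b r (List.ofFn fun i => (w i - b)⁻¹) := by
    rw [List.ofFn_succ]
    refine stairSum_cancel r ?_ _
    rw [show b - t - b = -t by ring, Fin.cons_zero]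
    field_simp
    ring
  rw [stairRhs_cons, hl, stairRhs, vdm_cons, Fin.prod_univ_succ, Fin.prod_univ_succ]
  simp only [Fin.cons_zero, Fin.cons_succ]
  have hp : ∏ i, (w i * (w i - b) - t * (t - b)) = (∏ i, (w i - (b - t))) * ∏ i, (w i - t) := by
    rw [← Finset.prod_mul_distrib]
    exact Finset.prod_congr rfl fun i _ => by ring
  rw [hp, show -(t * (t - b)) = (b - t - b) * (t - b) by ring, mul_pow, mul_pow]
  ring

/-- Strong induction on the number of variables. With n further variables fixed, both sides are
polynomials of degree at most 2n in the first one, and they agree at the 2n + 1 points 0, w_i, b -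
w_i: by the pole reduction, by the vanishing of both alternating sides, and by cancellation of x ⊕
x_i = 0. -/
theorem stairDet_eq_stairRhs {b : ℝ} (hb : 0 < b) : ∀ (n r : ℕ), r ≤ n → ∀ w : Fin n → ℝ,
    Function.Injective w → (∀ i, b < w i) → stairDet b r w = stairRhs b r w := by
  intro n
  induction n using Nat.strong_induction_on with
  | _ n IH =>
  intro r hrn w hw hbw
  rcases r with _ | r
  · rw [stairDet_rank_zero, stairRhs, stairSum_zero]; simp
  obtain ⟨n, rfl⟩ : ∃ m, n = m + 1 := ⟨n - 1, by omega⟩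
  obtain ⟨t₀, w, rfl⟩ : ∃ t v, w = (Fin.cons t v : Fin (n + 1) → ℝ) :=
    ⟨w 0, Fin.tail w, (Fin.cons_self_tail w).symm⟩
  have hw' : Function.Injective w := fun i j h => Fin.succ_injective _ (hw (by simpa using h))
  have hbw' : ∀ i, b < w i := fun i => by simpa using hbw i.succ
  have ht₀ : b < t₀ := by simpa using hbw 0
  have hr : r ≤ n := by omega
  set xs := List.ofFn fun i => (w i - b)⁻¹ with hxs
  obtain ⟨C, hC0, hC⟩ := exists_stairSum_eq_sum b (r + 1) xs
  rw [stairSum_zero_cons] at hC0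
  let minor : Fin (n + 1) → ℝ := fun j =>
    (Matrix.of fun i k : Fin n => stairEntry b (r + 1) (j.succAbove k) (w i)).det
  let P : Polynomial ℝ := ∑ j : Fin (n + 1), Polynomial.C ((-1) ^ (j : ℕ) * minor j) *
    stairPoly b (r + 1) j
  let G : Polynomial ℝ := ∑ i ∈ range (r + 2), Polynomial.C (C i) *
    (Polynomial.X - Polynomial.C b) ^ (r + 1 - i)
  let V : Polynomial ℝ := ∏ i, (Polynomial.C (w i) - Polynomial.X)
  let Q : Polynomial ℝ := Polynomial.C ((∏ i, (w i - b)) ^ (r + 1) * vdm w) * (V * G)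
  have hP : ∀ t, P.eval t = stairDet b (r + 1) (Fin.cons t w : Fin (n + 1) → ℝ) := by
    intro t
    rw [stairDet, Matrix.det_succ_row_zero]
    simp only [P, Polynomial.eval_finsetSum, Polynomial.eval_mul, Polynomial.eval_C, stairPoly_eval]
    refine Finset.sum_congr rfl fun j _ => ?_
    have : ((Matrix.of fun i j : Fin (n + 1) => stairEntry b (r + 1) j
        ((Fin.cons t w : Fin (n + 1) → ℝ) i)).submatrix Fin.succ j.succAbove).det = minor j := rfl
    rw [this]
    simp only [Matrix.of_apply, Fin.cons_zero]
    ring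
  have hQ : ∀ t, t ≠ b → Q.eval t = stairRhs b (r + 1) (Fin.cons t w : Fin (n + 1) → ℝ) := by
    intro t ht
    have ht' := sub_ne_zero.2 ht
    have hG : G.eval t = (t - b) ^ (r + 1) * stairSum b (r + 1) ((t - b)⁻¹ :: xs) := by
      rw [hC, Finset.mul_sum]
      simp only [G, Polynomial.eval_finsetSum, Polynomial.eval_mul, Polynomial.eval_C,
        Polynomial.eval_pow, Polynomial.eval_sub, Polynomial.eval_X]
      refine Finset.sum_congr rfl fun i hi => ?_
      have hi' : i ≤ r + 1 := by simp at hi; omega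
      rw [inv_pow, ← mul_assoc, ← pow_sub₀ _ ht' hi', mul_comm]
    rw [stairRhs_cons]
    simp only [Q, V, Polynomial.eval_mul, Polynomial.eval_C, hG, Polynomial.eval_prod,
      Polynomial.eval_sub, Polynomial.eval_X]
    ring
  have hdeg : (P - Q).natDegree ≤ 2 * n := by
    refine (Polynomial.natDegree_sub_le _ _).trans (max_le ?_ ?_)
    · refine Polynomial.natDegree_sum_le_of_forall_le _ _ fun j _ => ?_
      refine (Polynomial.natDegree_C_mul_le _ _).trans ?_
      exact (stairPoly_natDegree_le b _ _).trans (by omega)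
    · refine (Polynomial.natDegree_C_mul_le _ _).trans (Polynomial.natDegree_mul_le.trans ?_)
      have h1 : V.natDegree ≤ n := by
        refine (Polynomial.natDegree_prod_le _ _).trans ?_
        refine (Finset.sum_le_card_nsmul _ _ 1 fun i _ => ?_).trans (by simp)
        exact (Polynomial.natDegree_sub_le _ _).trans (by simp)
      have h2 : G.natDegree ≤ n := by
        refine Polynomial.natDegree_sum_le_of_forall_le _ _ fun i _ => ?_
        by_cases hi : r + 1 - i ≤ n
        · refine (Polynomial.natDegree_C_mul_le _ _).trans ?_
          refine Polynomial.natDegree_pow_le.trans ?_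
          rw [Polynomial.natDegree_X_sub_C, mul_one]; exact hi
        -- The only term of too high degree has coefficient C 0, a sum for r + 1 rows in n = r
        -- variables, hence zero.
        · obtain ⟨rfl, rfl⟩ : i = 0 ∧ n = r := by omega
          rw [hC0, stairSum_eq_zero (by simp [hxs])]
          simp
      omega
  have hzero : P - Q = 0 := by
    -- The nodes are distinct because w_i > b > 0 makes b - w_i negative.
    let f : Option (Fin n ⊕ Fin n) → ℝ
      | none => 0
      | some (Sum.inl i) => w i
      | some (Sum.inr i) => b - w i
    refine Polynomial.eq_zero_of_natDegree_lt_card_of_eval_eq_zero (P - Q) (f := f) ?_ ?_ ?_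
    · rintro (_ | i | i) (_ | j | j) h <;> simp only [f] at h
      · rfl
      · have := hbw' j; linarith
      · have := hbw' j; linarith
      · have := hbw' i; linarith
      · rw [hw' h]
      · have := hbw' i; have := hbw' j; linarith
      · have := hbw' i; linarith
      · have := hbw' i; have := hbw' j; linarith
      · rw [hw' (show w i = w j by linarith)]
    · rintro (_ | i | i) <;> simp only [f, Polynomial.eval_sub, sub_eq_zero]
      · rw [hP, hQ 0 hb.ne, stairDet_cons_zero, stairRhs_cons, IH n (by omega) r hr w hw' hbw', zero_sub,
          inv_neg, stairSum_pole hb.ne', stairRhs, Finset.prod_mul_distrib]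
        have e : (-b) ^ (r + 1) * (-b⁻¹) ^ (r + 1) = 1 := by
          rw [← mul_pow, neg_mul_neg, mul_inv_cancel₀ hb.ne', one_pow]
        simp only [sub_zero]
        rw [pow_succ (∏ i, (w i - b)) r]
        linear_combination (-(∏ i, w i) * (∏ i, (w i - b)) * ((∏ i, (w i - b)) ^ r *
          stairSum b r (List.ofFn fun i => (w i - b)⁻¹) * vdm w)) * e
      · rw [hP, hQ _ (hbw' i).ne', stairRhs_cons,
          stairDet_eq_zero (i := 0) (j := i.succ) (Fin.succ_ne_zero i).symm (fun _ _ => by simp),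
          Finset.prod_eq_zero (f := fun k => w k - w i) (Finset.mem_univ i) (sub_self _)]
        ring
      · have hbi := hbw' i
        rw [hP, hQ _ (by linarith)]
        obtain ⟨m, rfl⟩ : ∃ m, n = m + 1 := ⟨n - 1, by have := i.2; omega⟩
        have main : ∀ v : Fin (m + 1) → ℝ, Function.Injective v → (∀ i, b < v i) →
            stairDet b (r + 1) (Fin.cons (b - v 0) v : Fin (m + 2) → ℝ) =
              stairRhs b (r + 1) (Fin.cons (b - v 0) v : Fin (m + 2) → ℝ) := by
          intro v hv hbv
          obtain ⟨s, v, rfl⟩ : ∃ s y, v = (Fin.cons s y : Fin (m + 1) → ℝ) :=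
            ⟨v 0, Fin.tail v, (Fin.cons_self_tail v).symm⟩
          have hs : b < s := by simpa using hbv 0
          rw [Fin.cons_zero, stairRhs_cancel (by linarith) hs.ne']
          -- With so few variables the right side has fewer variables than rows, and every column of
          -- the determinant is a power of w(w - b), which takes equal values at s and b - s.
          rcases Nat.lt_or_ge m (r + 1) with hm | hm
          · rw [stairDet_eq_zero (i := 0) (j := 1) (by simp), stairRhs, stairSum_eq_zero (by simpa using hm)]
            · simp
            · intro k hk
              have e1 : min k (r + 1) = k := by omega
              have e2 : k - (r + 1) = 0 := by omega
              simp only [stairEntry, e1, e2, pow_zero]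
              congr 2
              change (b - s) * (b - s - b) = s * (s - b)
              ring
          · rw [stairDet_cancel b hm, IH m (by omega) (r + 1) hm v
              (fun i j h => Fin.succ_injective _ (hv (by simpa using h)))
              (fun i => by simpa using hbv i.succ)]
        by_cases hi : i = 0
        · subst hi; exact main w hw' hbw'
        -- Both sides are alternating in the remaining variables, so index i may be moved to the
        -- front.
        · have h := main (w ∘ Equiv.swap 0 i) (hw'.comp (Equiv.injective _)) (fun _ => hbw' _)
          rw [Function.comp_apply, Equiv.swap_apply_left,
            stairRhs_cons_swap hb _ _ hbw' _ _ (Ne.symm hi), cons_comp_swap, stairDet_perm,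
            Equiv.Perm.sign_swap (fun e => hi (Fin.succ_injective _ e).symm)] at h
          simpa using h
    · simp only [Fintype.card_option, Fintype.card_sum, Fintype.card_fin]; omega
  rw [← hP, ← hQ t₀ ht₀.ne', sub_eq_zero.1 hzero]

/-! ### Specialization to variables equal to one -/

/-- The exponents `λ_j + n - 1 - j` (with `j` counted from zero) of the staircase `λ = δ_{r+1}`. -/
def stairExp (n r j : ℕ) : ℕ := (r - j) + (n - 1 - j)

/-- Substituting w = b + 1/x gives w(w - b) = (1 + bx)/x², so multiplying row i by x_i^{n-1+r}
clears all denominators and leaves the bialternant of the Grothendieck polynomial of δ_{r+1}. -/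
theorem stairSum_mul_prod {b : ℝ} (hb : 0 < b) {n r : ℕ} (hr : r ≤ n) {x : Fin n → ℝ}
    (hx : Function.Injective x) (hpos : ∀ i, 0 < x i) :
    stairSum b r (List.ofFn x) * ∏ i, ∏ j ∈ Ioi i, (x i - x j) =
      (Matrix.of fun i j : Fin n => x i ^ stairExp n r j * (1 + b * x i) ^ (j : ℕ)).det := by
  have hx0 : ∀ i, x i ≠ 0 := fun i => (hpos i).ne'
  set w : Fin n → ℝ := fun i => b + (x i)⁻¹ with hw
  have key := stairDet_eq_stairRhs hb n r hr w
    (fun i j h => hx (inv_injective (add_left_cancel h)))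
    (fun i => by simp only [hw]; have := inv_pos.2 (hpos i); linarith)
  have h1 : (∏ i, x i) ^ (n - 1 + r) * stairDet b r w =
      (Matrix.of fun i j : Fin n => x i ^ stairExp n r j * (1 + b * x i) ^ (j : ℕ)).det := by
    rw [stairDet, ← Finset.prod_pow, ← Matrix.det_mul_column]
    congr 1
    ext i j
    simp only [Matrix.of_apply, stairEntry, hw]
    have e1 : b + (x i)⁻¹ = (1 + b * x i) * (x i)⁻¹ := by
      have := hx0 i; field_simp; ring
    have e2 : (1 + b * x i) * (x i)⁻¹ * ((1 + b * x i) * (x i)⁻¹ - b) =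
        (1 + b * x i) * (x i)⁻¹ ^ 2 := by
      have := hx0 i; field_simp; ring
    have hj : (j : ℕ) < n := j.2
    have e3 : n - 1 + r = stairExp n r j + (2 * min (j : ℕ) r + (j - r)) := by
      unfold stairExp; omega
    have e4 : (j : ℕ) = min (j : ℕ) r + (j - r) := by omega
    rw [e1, e2, e3]
    conv_rhs => rw [e4]
    have e5 : x i ^ (2 * min (j : ℕ) r + (j - r)) * ((x i)⁻¹ ^ (2 * min (j : ℕ) r + (j - r))) = 1 := by
      rw [← mul_pow, mul_inv_cancel₀ (hx0 i), one_pow]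
    simp only [mul_pow, ← pow_mul, pow_add] at e5 ⊢
    rw [← e4]
    linear_combination (x i ^ stairExp n r j * (1 + b * x i) ^ min (j : ℕ) r *
      (1 + b * x i) ^ ((j : ℕ) - r)) * e5
  have h2 : (∏ i, x i) ^ (n - 1) * vdm w = ∏ i, ∏ j ∈ Ioi i, (x i - x j) := by
    have : (∏ i, x i) ^ (n - 1) * vdm w =
        (Matrix.projVandermonde (fun i => 1 + b * x i) x).det := by
      rw [vdm, ← Finset.prod_pow, ← Matrix.det_mul_column]
      congr 1
      ext i j
      rw [Matrix.projVandermonde_apply, Matrix.of_apply, Matrix.vandermonde_apply]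
      have hj : (j : ℕ) < n := j.2
      have e1 : w i = (1 + b * x i) * (x i)⁻¹ := by
        have := hx0 i; simp only [hw]; field_simp; ring
      rw [e1, show n - 1 = j.rev + j by rw [Fin.val_rev]; omega, mul_pow, pow_add]
      have e5 : x i ^ (j : ℕ) * (x i)⁻¹ ^ (j : ℕ) = 1 := by
        rw [← mul_pow, mul_inv_cancel₀ (hx0 i), one_pow]
      linear_combination (x i ^ (j.rev : ℕ) * (1 + b * x i) ^ (j : ℕ)) * e5
    rw [this, Matrix.det_projVandermonde]
    refine Finset.prod_congr rfl fun i _ => Finset.prod_congr rfl fun j _ => by ring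
  rw [← h1, ← h2, key, stairRhs]
  have h3 : ∀ i, w i - b = (x i)⁻¹ := fun i => by simp [hw]
  simp only [h3, inv_inv, Finset.prod_inv_distrib]
  have h4 : (∏ i, x i) ^ r * ((∏ i, x i)⁻¹) ^ r = 1 := by
    rw [← mul_pow, mul_inv_cancel₀ (Finset.prod_ne_zero_iff.2 fun i _ => hx0 i), one_pow]
  rw [pow_add]
  linear_combination (-(∏ i, x i) ^ (n - 1) * stairSum b r (List.ofFn x) * vdm w) * h4

/-- At x_i = q^i the binomial theorem writes each column as a combination of geometric progressions
in i; by multilinearity every term is a Vandermonde determinant. -/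
theorem det_stairExp_expand (b q : ℝ) (n r : ℕ) :
    (Matrix.of fun i j : Fin n =>
      (q ^ (i : ℕ)) ^ stairExp n r j * (1 + b * q ^ (i : ℕ)) ^ (j : ℕ)).det =
    ∑ κ ∈ Fintype.piFinset fun j : Fin n => range ((j : ℕ) + 1),
      (∏ j : Fin n, ((Nat.choose j (κ j) : ℕ) : ℝ) * b ^ κ j) *
        ∏ i : Fin n, ∏ j ∈ Ioi i, (q ^ (stairExp n r j + κ j) - q ^ (stairExp n r i + κ i)) := by
  have h : (Matrix.of fun i j : Fin n =>
      (q ^ (i : ℕ)) ^ stairExp n r j * (1 + b * q ^ (i : ℕ)) ^ (j : ℕ)).transpose =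
      fun j : Fin n => ∑ k ∈ range ((j : ℕ) + 1), (((Nat.choose j k : ℕ) : ℝ) * b ^ k) •
        fun i : Fin n => (q ^ (stairExp n r j + k)) ^ (i : ℕ) := by
    ext j i
    simp only [Matrix.transpose_apply, Matrix.of_apply, Finset.sum_apply, Pi.smul_apply, smul_eq_mul]
    rw [add_comm 1, add_pow, Finset.mul_sum]
    refine Finset.sum_congr rfl fun k _ => ?_
    rw [one_pow, mul_pow, ← pow_mul, ← pow_mul, ← pow_mul, add_mul, pow_add,
      mul_comm (i : ℕ) (stairExp n r j), mul_comm (i : ℕ) k]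
    ring
  rw [← Matrix.det_transpose, h]
  change (Matrix.detRowAlternating (R := ℝ) (n := Fin n)).toMultilinearMap _ = _
  rw [MultilinearMap.map_sum_finset]
  refine Finset.sum_congr rfl fun κ _ => ?_
  rw [MultilinearMap.map_smul_univ, smul_eq_mul]
  congr 1
  exact Matrix.det_vandermonde fun j => q ^ (stairExp n r j + κ j)

theorem pow_sub_pow_eq_geom (q : ℝ) (a c : ℕ) :
    q ^ a - q ^ c = (∑ k ∈ range a, q ^ k - ∑ k ∈ range c, q ^ k) * (q - 1) := by
  rw [sub_mul, geom_sum_mul, geom_sum_mul]; ring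

/-! #### Continuity -/

theorem heckeFactor_continuous {b : ℝ} (c : ℕ) {x : ℝ → ℝ} (hx : Continuous x)
    {f : ℝ → (ℕ → ℕ) → ℝ} (hf : ∀ d, Continuous fun q => f q d) (d : ℕ → ℕ) :
    Continuous fun q => heckeFactor (removalOp b) c (x q) (f q) d := by
  simp only [heckeFactor_apply]
  refine (hf d).add (hx.mul ?_)
  by_cases h : IsRemovable d c
  · simp only [removalOp_of_removable h]
    exact (hf _).add (continuous_const.mul (hf d))
  · simp only [removalOp_of_not_removable h]
    exact continuous_const

theorem reflectionOp_continuous {b : ℝ} (N : ℕ) {x : ℝ → ℝ} (hx : Continuous x) :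
    ∀ {f : ℝ → (ℕ → ℕ) → ℝ} (_ : ∀ d, Continuous fun q => f q d) (d : ℕ → ℕ),
    Continuous fun q => reflectionOp (removalOp b) N (x q) (f q) d := by
  induction N using Nat.twoStepInduction with
  | zero => exact fun hf d => hf d
  | one => exact fun hf d => heckeFactor_continuous 0 hx hf d
  | more N _ ih =>
    exact fun hf d => heckeFactor_continuous _ hx (ih (heckeFactor_continuous _ hx hf)) d

theorem stairSum_continuous (b : ℝ) (r : ℕ) (xs : List (ℝ → ℝ)) (hxs : ∀ x ∈ xs, Continuous x) :
    Continuous fun q => stairSum b r (xs.map fun x => x q) := by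
  have : ∀ d, Continuous fun q =>
      ((xs.map fun x => x q).map (reflectionOp (removalOp b) r)).prod vacuum d := by
    induction xs with
    | nil => exact fun d => continuous_const
    | cons x xs ih =>
      simp only [List.map_cons, List.prod_cons, Module.End.mul_apply]
      exact reflectionOp_continuous r (hxs x (by simp)) (ih fun y hy => hxs y (by simp [hy]))
  exact this _

/-- The bialternant degenerates at equal variables. For x_i = q^i with q > 1 each difference of
powers carries a factor q - 1; these cancel, leaving differences of q-integers, and continuity
allows q → 1. -/
theorem stairSum_ones {b : ℝ} (hb : 0 < b) {n r : ℕ} (hr : r ≤ n) :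
    stairSum b r (List.replicate n 1) * ∏ i : Fin n, ∏ j ∈ Ioi i, (((i : ℕ) : ℝ) - (j : ℕ)) =
    ∑ κ ∈ Fintype.piFinset fun j : Fin n => range ((j : ℕ) + 1),
      (∏ j : Fin n, ((Nat.choose j (κ j) : ℕ) : ℝ) * b ^ κ j) *
        ∏ i : Fin n, ∏ j ∈ Ioi i, (((stairExp n r j + κ j : ℕ) : ℝ) - (stairExp n r i + κ i : ℕ)) := by
  let g : ℕ → ℝ → ℝ := fun a q => ∑ k ∈ range a, q ^ k
  have hg : ∀ a, Continuous (g a) := fun a => by fun_prop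
  have hg1 : ∀ a, g a 1 = a := fun a => by simp [g]
  let L : ℝ → ℝ := fun q => stairSum b r (List.ofFn fun i : Fin n => q ^ (i : ℕ)) *
    ∏ i : Fin n, ∏ j ∈ Ioi i, (g i q - g j q)
  let R : ℝ → ℝ := fun q => ∑ κ ∈ Fintype.piFinset fun j : Fin n => range ((j : ℕ) + 1),
      (∏ j : Fin n, ((Nat.choose j (κ j) : ℕ) : ℝ) * b ^ κ j) *
        ∏ i : Fin n, ∏ j ∈ Ioi i, (g (stairExp n r j + κ j) q - g (stairExp n r i + κ i) q)
  have hL : Continuous L := by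
    refine Continuous.mul ?_ ?_
    · have := stairSum_continuous b r (List.ofFn fun (i : Fin n) (q : ℝ) => q ^ (i : ℕ)) (by
        intro x hx
        obtain ⟨i, rfl⟩ := (List.mem_ofFn' _ _).1 hx
        fun_prop)
      simpa only [List.map_ofFn, Function.comp_def] using this
    · exact continuous_finsetProd _ fun i _ => continuous_finsetProd _ fun j _ =>
        (hg _).sub (hg _)
  have hR : Continuous R := continuous_finsetSum _ fun κ _ => continuous_const.mul
    (continuous_finsetProd _ fun i _ => continuous_finsetProd _ fun j _ => (hg _).sub (hg _))
  have hLR : ∀ q, 1 < q → L q = R q := by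
    intro q hq
    have h := stairSum_mul_prod hb hr (x := fun i : Fin n => q ^ (i : ℕ))
      (fun i j h => Fin.ext (pow_right_injective₀ (by linarith) hq.ne' h)) (fun i => by positivity)
    rw [det_stairExp_expand] at h
    simp only [pow_sub_pow_eq_geom, Finset.prod_mul_distrib] at h
    have hne : (∏ i : Fin n, ∏ j ∈ Ioi i, (q - 1)) ≠ 0 :=
      Finset.prod_ne_zero_iff.2 fun i _ => Finset.prod_ne_zero_iff.2 fun j _ => by linarith
    refine mul_right_cancel₀ hne ?_
    simp only [L, R, Finset.sum_mul, mul_assoc, Finset.prod_mul_distrib]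
    simpa only [Finset.prod_mul_distrib, mul_assoc] using h
  have h1 : L 1 = R 1 := by
    refine tendsto_nhds_unique_of_eventuallyEq (l := nhdsWithin (1 : ℝ) (Set.Ioi 1))
      ((hL.tendsto 1).mono_left nhdsWithin_le_nhds) ((hR.tendsto 1).mono_left nhdsWithin_le_nhds) ?_
    filter_upwards [self_mem_nhdsWithin] with q hq using hLR q hq
  simpa only [L, R, hg1, one_pow, List.ofFn_const] using h1

/-! ### Set-valued fillings by times

Time `t` may only be used on the diagonal `ct t`, so that a filling of a shape by sets of times is
a finite set of pairs `(i, t)`, meaning that the box in row `i` on the diagonal `ct t` contains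
`t`. -/

/-- Set-valued fillings of the shape `d` by times `t < m`, strictly increasing along rows and
columns. -/
structure IsTimed (ct : ℕ → ℕ) (d : ℕ → ℕ) (m : ℕ) (S : Finset (ℕ × ℕ)) : Prop where
  mem : ∀ i t, (i, t) ∈ S → t < m ∧ i < d (ct t)
  cover : ∀ c i, i < d c → ∃ t, (i, t) ∈ S ∧ ct t = c
  right : ∀ i t t', (i, t) ∈ S → (i, t') ∈ S → ct t' = ct t + 1 → t < t'
  down : ∀ i t t', (i, t) ∈ S → (i + 1, t') ∈ S → ct t = ct t' + 1 → t < t'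

open Classical in
/-- The finite set of all fillings, for shapes with at most `K` rows. -/
def timedFillings (K : ℕ) (ct : ℕ → ℕ) (d : ℕ → ℕ) (m : ℕ) : Finset (Finset (ℕ × ℕ)) :=
  (range K ×ˢ range m).powerset.filter (IsTimed ct d m)

/-- Diagonal lengths of shifted shapes with at most `K` rows and with fewer than `N` columns. -/
structure IsShiftedShape (K N : ℕ) (d : ℕ → ℕ) : Prop where
  le : ∀ c, d (c + 1) ≤ d c
  le_succ : ∀ c, d c ≤ d (c + 1) + 1
  bound : ∀ c, d c ≤ K
  support : ∀ c, N ≤ c → d c = 0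

/-- The generating function of fillings. -/
def timedSum (b : ℝ) (K N : ℕ) (ct : ℕ → ℕ) (m : ℕ) (d : ℕ → ℕ) : ℝ :=
  ∑ S ∈ timedFillings K ct d m, b ^ #S * b⁻¹ ^ (∑ c ∈ range N, d c)

theorem mem_timedFillings {K N : ℕ} {ct d : ℕ → ℕ} {m : ℕ} (hd : IsShiftedShape K N d)
    {S : Finset (ℕ × ℕ)} : S ∈ timedFillings K ct d m ↔ IsTimed ct d m S := by
  simp only [timedFillings, mem_filter, mem_powerset, and_iff_right_iff_imp]
  rintro h ⟨i, t⟩ hit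
  have := h.mem i t hit
  have := hd.bound (ct t)
  simp; omega

theorem IsShiftedShape.removeBox {K N : ℕ} {d : ℕ → ℕ} (hd : IsShiftedShape K N d) {c : ℕ}
    (h : IsRemovable d c) : IsShiftedShape K N (_root_.removeBox d c) := by
  have h1 := h.1
  have h2 := h.2
  have key : ∀ e, _root_.removeBox d c e = if e = c then d c - 1 else d e := fun e => by
    split_ifs with he
    · rw [he, removeBox_same]
    · rw [removeBox_of_ne he]
  refine ⟨fun e => ?_, fun e => ?_, fun e => ?_, fun e he => ?_⟩
  · have := hd.le e; rw [key, key]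
    split_ifs with h3 h4 h4
    · omega
    · subst h3; simp; omega
    · subst h4; omega
    · exact this
  · have := hd.le_succ e; rw [key, key]
    split_ifs with h3 h4 h4
    · omega
    · subst h3; omega
    · subst h4; rw [Nat.add_sub_cancel] at h2; omega
    · exact this
  · have := hd.bound e; have := hd.bound c; rw [key]; split_ifs <;> omega
  · have := hd.support e he; rw [key]; split_ifs with h3
    · subst h3; omega
    · exact this

theorem sum_removeBox {N : ℕ} {d : ℕ → ℕ} {c : ℕ} (hc : c < N) (h : IsRemovable d c) :
    ∑ e ∈ range N, d e = ∑ e ∈ range N, removeBox d c e + 1 := by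
  have hc' : c ∈ range N := by simpa using hc
  rw [← Finset.add_sum_erase _ _ hc', ← Finset.add_sum_erase (range N) (removeBox d c) hc',
    removeBox_same, Finset.sum_congr rfl fun e he => removeBox_of_ne (Finset.ne_of_mem_erase he)]
  have := h.1
  omega

/-- A box to the right of or below one containing the last time would need a later time, so the last
time can occur only in a removable corner. -/
theorem IsTimed.last {K N : ℕ} {ct d : ℕ → ℕ} {m : ℕ} {S : Finset (ℕ × ℕ)}
    (hd : IsShiftedShape K N d) (h : IsTimed ct d (m + 1) S) {i : ℕ} (hi : (i, m) ∈ S) :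
    IsRemovable d (ct m) ∧ i = d (ct m) - 1 := by
  have h0 := (h.mem i m hi).2
  have h1 : d (ct m + 1) ≤ i := by
    by_contra hlt
    obtain ⟨t, ht, hct⟩ := h.cover (ct m + 1) i (by omega)
    have := h.right i m t hi ht hct
    have := (h.mem i t ht).1
    omega
  have h2 := hd.le_succ (ct m)
  refine ⟨⟨by omega, ?_⟩, by omega⟩
  by_contra hcon
  push Not at hcon
  obtain ⟨hne, hd'⟩ := hcon
  have h3 := hd.le (ct m - 1)
  rw [show ct m - 1 + 1 = ct m by omega] at h3
  obtain ⟨t, ht, hct⟩ := h.cover (ct m - 1) (i + 1) (by omega)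
  have := h.down i m t hi ht (by omega)
  have := (h.mem _ t ht).1
  omega

theorem isTimed_succ_iff {ct d : ℕ → ℕ} {m : ℕ} {S : Finset (ℕ × ℕ)} (hS : ∀ i, (i, m) ∉ S) :
    IsTimed ct d (m + 1) S ↔ IsTimed ct d m S := by
  constructor
  · intro h
    refine ⟨fun i t hit => ⟨?_, (h.mem i t hit).2⟩, h.cover, h.right, h.down⟩
    have := (h.mem i t hit).1
    have : t ≠ m := by rintro rfl; exact hS i hit
    omega
  · intro h
    exact ⟨fun i t hit => ⟨(h.mem i t hit).1.trans (Nat.lt_succ_self m), (h.mem i t hit).2⟩,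
      h.cover, h.right, h.down⟩

theorem IsTimed.insert {ct d d' : ℕ → ℕ} {m : ℕ} {S : Finset (ℕ × ℕ)}
    (hr : IsRemovable d (ct m)) (hd' : d' = d ∨ d' = removeBox d (ct m)) (h : IsTimed ct d' m S) :
    IsTimed ct d (m + 1) (insert (d (ct m) - 1, m) S) := by
  have h1 := hr.1
  have h2 := hr.2
  have hle : ∀ c, d' c ≤ d c := by
    intro c
    rcases hd' with rfl | rfl
    · exact le_rfl
    · by_cases hc : c = ct m
      · rw [hc, removeBox_same]; omega
      · rw [removeBox_of_ne hc]
  have hge : ∀ c i, i < d c → i < d' c ∨ (c = ct m ∧ i = d (ct m) - 1) := by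
    intro c i hi
    rcases hd' with rfl | rfl
    · exact Or.inl hi
    · by_cases hc : c = ct m
      · subst hc; rw [removeBox_same]; omega
      · rw [removeBox_of_ne hc]; exact Or.inl hi
  refine ⟨fun i t hit => ?_, fun c i hi => ?_, fun i t t' ht ht' hct => ?_,
    fun i t t' ht ht' hct => ?_⟩
  · rcases mem_insert.1 hit with e | hit
    · simp only [Prod.mk.injEq] at e
      obtain ⟨rfl, rfl⟩ := e
      exact ⟨Nat.lt_succ_self _, by omega⟩
    · have := h.mem i t hit
      have := hle (ct t)
      omega
  · rcases hge c i hi with hi' | ⟨rfl, rfl⟩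
    · obtain ⟨t, ht, hct⟩ := h.cover c i hi'
      exact ⟨t, mem_insert_of_mem ht, hct⟩
    · exact ⟨m, mem_insert_self _ _, rfl⟩
  · rcases mem_insert.1 ht with e | hs <;> rcases mem_insert.1 ht' with e' | hs'
    · simp only [Prod.mk.injEq] at e e'
      obtain ⟨_, rfl⟩ := e
      obtain ⟨_, rfl⟩ := e'
      omega
    · simp only [Prod.mk.injEq] at e
      obtain ⟨rfl, rfl⟩ := e
      have := (h.mem _ _ hs').2
      have := hle (ct t')
      rw [hct] at *
      omega
    · simp only [Prod.mk.injEq] at e'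
      obtain ⟨_, rfl⟩ := e'
      exact (h.mem _ _ hs).1
    · exact h.right i t t' hs hs' hct
  · rcases mem_insert.1 ht with e | hs <;> rcases mem_insert.1 ht' with e' | hs'
    · simp only [Prod.mk.injEq] at e e'
      obtain ⟨_, rfl⟩ := e
      obtain ⟨_, rfl⟩ := e'
      omega
    · simp only [Prod.mk.injEq] at e
      obtain ⟨rfl, rfl⟩ := e
      have h3 := (h.mem _ _ hs').2
      have h4 := hle (ct t')
      rw [show ct t - 1 = ct t' by omega] at h2
      omega
    · simp only [Prod.mk.injEq] at e'
      obtain ⟨_, rfl⟩ := e'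
      exact (h.mem _ _ hs).1
    · exact h.down i t t' hs hs' hct

/-- The two cases are whether the corner keeps another entry. They correspond to the two terms of
`removalOp` on a removable box. -/
theorem IsTimed.erase {K N : ℕ} {ct d : ℕ → ℕ} {m : ℕ} {S : Finset (ℕ × ℕ)}
    (hd : IsShiftedShape K N d) (h : IsTimed ct d (m + 1) S) :
    IsTimed ct d m (S.erase (d (ct m) - 1, m)) ∨
      IsTimed ct (removeBox d (ct m)) m (S.erase (d (ct m) - 1, m)) := by
  set e : ℕ × ℕ := (d (ct m) - 1, m) with he
  have hsub : ∀ {p}, p ∈ S.erase e → p ∈ S := fun hp => mem_of_mem_erase hp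
  have hlt : ∀ i t, (i, t) ∈ S.erase e → t < m := by
    intro i t hit
    have h1 := (h.mem i t (hsub hit)).1
    have : t ≠ m := by
      rintro rfl
      exact ne_of_mem_erase hit (by rw [(h.last hd (hsub hit)).2])
    omega
  by_cases hex : ∃ t, (d (ct m) - 1, t) ∈ S.erase e ∧ ct t = ct m
  · left
    refine ⟨fun i t hit => ⟨hlt i t hit, (h.mem i t (hsub hit)).2⟩, fun c i hi => ?_,
      fun i t t' ht ht' => h.right i t t' (hsub ht) (hsub ht'),
      fun i t t' ht ht' => h.down i t t' (hsub ht) (hsub ht')⟩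
    obtain ⟨t, ht, hct⟩ := h.cover c i hi
    by_cases hte : (i, t) = e
    · simp only [he, Prod.mk.injEq] at hte
      obtain ⟨t', ht', hct'⟩ := hex
      refine ⟨t', by rw [hte.1]; exact ht', ?_⟩
      rw [hct', ← hct, hte.2]
    · exact ⟨t, mem_erase.2 ⟨hte, ht⟩, hct⟩
  · right
    refine ⟨fun i t hit => ⟨hlt i t hit, ?_⟩, fun c i hi => ?_,
      fun i t t' ht ht' => h.right i t t' (hsub ht) (hsub ht'),
      fun i t t' ht ht' => h.down i t t' (hsub ht) (hsub ht')⟩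
    · have h1 := (h.mem i t (hsub hit)).2
      by_cases hc : ct t = ct m
      · rw [hc, removeBox_same]
        rw [hc] at h1
        have : i ≠ d (ct m) - 1 := by
          rintro rfl
          exact hex ⟨t, hit, hc⟩
        omega
      · rwa [removeBox_of_ne hc]
    · have hi' : i < d c := by
        by_cases hc : c = ct m
        · rw [hc, removeBox_same] at hi; rw [hc]; omega
        · rwa [removeBox_of_ne hc] at hi
      obtain ⟨t, ht, hct⟩ := h.cover c i hi'
      refine ⟨t, mem_erase.2 ⟨?_, ht⟩, hct⟩
      intro hte
      simp only [he, Prod.mk.injEq] at hte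
      rw [← hct, hte.2, removeBox_same, hte.1] at hi
      omega

/-- Fillings avoiding time m give the first term. In the others, erasing m either empties the
corner, which leaves the excess #S - |d| unchanged, or not, which costs one factor b. -/
theorem timedSum_succ {b : ℝ} (hb : b ≠ 0) {K N : ℕ} {ct : ℕ → ℕ} {m : ℕ} (hct : ct m < N)
    {d : ℕ → ℕ} (hd : IsShiftedShape K N d) :
    timedSum b K N ct (m + 1) d =
      timedSum b K N ct m d + removalOp b (ct m) (timedSum b K N ct m) d := by
  classical
  set c := ct m with hc
  set e : ℕ × ℕ := (d c - 1, m) with he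
  have hsplit := Finset.sum_filter_add_sum_filter_not (timedFillings K ct d (m + 1))
    (fun S => e ∈ S) (fun S => b ^ #S * b⁻¹ ^ (∑ c ∈ range N, d c))
  have hnot : (timedFillings K ct d (m + 1)).filter (fun S => e ∉ S) = timedFillings K ct d m := by
    ext S
    rw [mem_filter, mem_timedFillings hd, mem_timedFillings hd]
    constructor
    · rintro ⟨h, heS⟩
      refine (isTimed_succ_iff fun i hi => heS ?_).1 h
      have := (h.last hd hi).2
      rw [he, hc, ← this]; exact hi
    · intro h
      have hm : ∀ i, (i, m) ∉ S := fun i hi => (lt_irrefl _ (h.mem i m hi).1)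
      exact ⟨(isTimed_succ_iff hm).2 h, hm _⟩
  rw [hnot] at hsplit
  rw [timedSum, ← hsplit, add_comm]
  congr 1
  by_cases hr : IsRemovable d c
  · rw [removalOp_of_removable hr]
    have hd' := hd.removeBox hr
    have hdisj : Disjoint (timedFillings K ct (removeBox d c) m) (timedFillings K ct d m) := by
      rw [Finset.disjoint_left]
      intro S h1 h2
      rw [mem_timedFillings hd'] at h1
      rw [mem_timedFillings hd] at h2
      obtain ⟨t, ht, hct⟩ := h2.cover c (d c - 1) (by have := hr.1; omega)
      have := (h1.mem _ _ ht).2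
      rw [hct, removeBox_same] at this
      omega
    have hnm : ∀ S ∈ timedFillings K ct (removeBox d c) m ∪ timedFillings K ct d m, e ∉ S := by
      intro S hS heS
      rw [mem_union, mem_timedFillings hd', mem_timedFillings hd] at hS
      rcases hS with h | h <;> exact lt_irrefl _ (h.mem _ _ heS).1
    have hbij : ∑ S ∈ timedFillings K ct d (m + 1) with e ∈ S,
        b ^ #S * b⁻¹ ^ (∑ c ∈ range N, d c) =
        ∑ S ∈ timedFillings K ct (removeBox d c) m ∪ timedFillings K ct d m,
          b ^ (#S + 1) * b⁻¹ ^ (∑ c ∈ range N, d c) := by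
      refine Finset.sum_nbij' (fun S => S.erase e) (fun S => insert e S) ?_ ?_ ?_ ?_ ?_
      · intro S hS
        rw [mem_filter, mem_timedFillings hd] at hS
        rw [mem_union, mem_timedFillings hd', mem_timedFillings hd]
        exact (hS.1.erase hd).symm
      · intro S hS
        rw [mem_union, mem_timedFillings hd', mem_timedFillings hd] at hS
        rw [mem_filter, mem_timedFillings hd]
        refine ⟨?_, mem_insert_self _ _⟩
        rcases hS with h | h
        · exact h.insert hr (Or.inr rfl)
        · exact h.insert hr (Or.inl rfl)
      · intro S hS
        exact Finset.insert_erase (mem_filter.1 hS).2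
      · intro S hS
        exact Finset.erase_insert (hnm S hS)
      · intro S hS
        rw [Finset.card_erase_add_one (mem_filter.1 hS).2]
    rw [hbij, Finset.sum_union hdisj, timedSum, timedSum, Finset.mul_sum]
    congr 1
    · refine Finset.sum_congr rfl fun S _ => ?_
      rw [sum_removeBox hct hr, pow_succ, pow_succ]
      field_simp
    · exact Finset.sum_congr rfl fun S _ => by ring
  · rw [removalOp_of_not_removable hr]
    refine Finset.sum_eq_zero fun S hS => absurd ?_ hr
    rw [mem_filter, mem_timedFillings hd] at hS
    exact (hS.1.last hd hS.2).1

theorem timedSum_zero {b : ℝ} {K N : ℕ} {ct : ℕ → ℕ} {d : ℕ → ℕ} (hd : IsShiftedShape K N d) :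
    timedSum b K N ct 0 d = vacuum d := by
  classical
  have hS : ∀ S, IsTimed ct d 0 S ↔ S = ∅ ∧ d = 0 := by
    intro S
    constructor
    · intro h
      have hS : S = ∅ := by
        rw [Finset.eq_empty_iff_forall_notMem]
        rintro ⟨i, t⟩ hit
        exact absurd (h.mem i t hit).1 (Nat.not_lt_zero _)
      refine ⟨hS, funext fun c => ?_⟩
      by_contra hne
      obtain ⟨t, ht, _⟩ := h.cover c 0 (Nat.pos_of_ne_zero hne)
      simp [hS] at ht
    · rintro ⟨rfl, rfl⟩
      exact ⟨by simp, by simp, by simp, by simp⟩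
  by_cases h0 : d = 0
  · have : timedFillings K ct d 0 = {∅} := by
      ext S; rw [mem_timedFillings hd, hS]; simp [h0]
    rw [timedSum, this]
    simp [vacuum, h0]
  · have : timedFillings K ct d 0 = ∅ := by
      ext S; rw [mem_timedFillings hd, hS]; simp [h0]
    rw [timedSum, this]
    simp [vacuum, h0]

/-- The product of the factors of the first `m` times. -/
def timedOp (b : ℝ) (ct : ℕ → ℕ) : ℕ → Module.End ℝ ((ℕ → ℕ) → ℝ)
  | 0 => 1
  | m + 1 => heckeFactor (removalOp b) (ct m) 1 * timedOp b ct m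

theorem timedSum_eq_timedOp {b : ℝ} (hb : b ≠ 0) {K N : ℕ} {ct : ℕ → ℕ} :
    ∀ (m : ℕ) (_ : ∀ t < m, ct t < N) {d : ℕ → ℕ} (_ : IsShiftedShape K N d),
      timedSum b K N ct m d = timedOp b ct m vacuum d
  | 0, _, d, hd => timedSum_zero hd
  | m + 1, hct, d, hd => by
    have ih := fun {d'} => timedSum_eq_timedOp (K := K) hb m (fun t ht => hct t (by omega)) (d := d')
    rw [timedSum_succ hb (hct m (by omega)) hd, timedOp, Module.End.mul_apply, heckeFactor_apply,
      one_mul, ih hd]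
    congr 1
    by_cases hr : IsRemovable d (ct m)
    · rw [removalOp_of_removable hr, removalOp_of_removable hr, ih hd, ih (hd.removeBox hr)]
    · rw [removalOp_of_not_removable hr, removalOp_of_not_removable hr]

theorem timedOp_add (b : ℝ) (ct : ℕ → ℕ) (m m' : ℕ) :
    timedOp b ct (m + m') = timedOp b (fun t => ct (m + t)) m' * timedOp b ct m := by
  induction m' with
  | zero => simp [timedOp]
  | succ k ih => rw [← add_assoc, timedOp, ih, timedOp, mul_assoc]

theorem timedOp_congr {b : ℝ} {ct ct' : ℕ → ℕ} {m : ℕ} (h : ∀ t < m, ct t = ct' t) :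
    timedOp b ct m = timedOp b ct' m := by
  induction m with
  | zero => rfl
  | succ k ih => rw [timedOp, timedOp, h k (by omega), ih fun t ht => h t (by omega)]

/-- The diagonal of the `o`-th step for each letter: `r - 1, …, 1, 0, 1, …, r - 1`. -/
def blockContent (r o : ℕ) : ℕ := (o - (r - 1)) + ((r - 1) - o)

theorem timedOp_block (b : ℝ) (r : ℕ) :
    timedOp b (blockContent r) (2 * r - 1) = reflectionOp (removalOp b) r 1 := by
  induction r using Nat.twoStepInduction with
  | zero => rfl
  | one => simp [timedOp, reflectionOp, blockContent]
  | more r _ ih =>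
    have e : 2 * (r + 2) - 1 = (1 + (2 * (r + 1) - 1)) + 1 := by omega
    rw [e, timedOp, timedOp_add, reflectionOp, ← ih, ← mul_assoc]
    have e1 : blockContent (r + 2) (1 + (2 * (r + 1) - 1)) = r + 1 := by
      unfold blockContent; omega
    have e2 : timedOp b (fun t => blockContent (r + 2) (1 + t)) (2 * (r + 1) - 1) =
        timedOp b (blockContent (r + 1)) (2 * (r + 1) - 1) :=
      timedOp_congr fun t _ => by unfold blockContent; omega
    have e3 : timedOp b (blockContent (r + 2)) 1 = heckeFactor (removalOp b) (r + 1) 1 := by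
      have : blockContent (r + 2) 0 = r + 1 := by unfold blockContent; omega
      rw [timedOp, timedOp, this, mul_one]
    rw [e1, e2, e3]

/-- The diagonal on which time `t` may be used. -/
def timeContent (r t : ℕ) : ℕ := blockContent r (t % (2 * r - 1))

theorem timedOp_timeContent (b : ℝ) (r n : ℕ) :
    timedOp b (timeContent r) (n * (2 * r - 1)) = reflectionOp (removalOp b) r 1 ^ n := by
  induction n with
  | zero => simp [timedOp]
  | succ n ih =>
    rw [Nat.succ_mul, timedOp_add, ih, pow_succ', ← timedOp_block]
    congr 1
    refine timedOp_congr fun t ht => ?_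
    rw [timeContent, Nat.mul_add_mod_of_lt ht]

theorem stair_isShiftedShape (r : ℕ) : IsShiftedShape r r (stair r) :=
  ⟨fun c => by simp [stair]; omega, fun c => by simp [stair]; omega, fun c => by simp [stair],
    fun c hc => by simp [stair]; omega⟩

theorem timeContent_lt {r t : ℕ} (hr : 0 < r) : timeContent r t < r := by
  have := Nat.mod_lt t (show 0 < 2 * r - 1 by omega)
  unfold timeContent blockContent; omega

theorem timedSum_stair {b : ℝ} (hb : b ≠ 0) (r n : ℕ) :
    timedSum b r r (timeContent r) (n * (2 * r - 1)) (stair r) =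
      stairSum b r (List.replicate n 1) := by
  rw [timedSum_eq_timedOp hb _ _ (stair_isShiftedShape r), timedOp_timeContent, stairSum,
    List.map_replicate, List.prod_replicate]
  rcases Nat.eq_zero_or_pos r with rfl | hr
  · simp
  · exact fun t _ => timeContent_lt hr

/-! ### Shifted set-valued tableaux as fillings by times -/

theorem strictStaircase_parts_length (r : ℕ) : (strictStaircase (r + 1)).parts.length = r := by
  simp [strictStaircase, staircaseParts]

theorem mem_strictStaircase_diagram {r : ℕ} {u : ℕ × ℕ} :
    u ∈ (strictStaircase (r + 1)).diagram ↔ u.1 ≤ u.2 ∧ u.2 < r := by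
  obtain ⟨i, j⟩ := u
  have hget : ∀ k : Fin (strictStaircase (r + 1)).parts.length,
      (strictStaircase (r + 1)).parts[k] = r - k := by
    intro k
    have hk : (k : ℕ) < r := by simpa [strictStaircase_parts_length] using k.2
    change (staircaseParts (r + 1))[(k : ℕ)]'k.2 = r - k
    simp [staircaseParts, List.getElem_reverse]
    omega
  simp only [StrictPartition.diagram, mem_biUnion, mem_univ, true_and, mem_product, mem_singleton,
    mem_Ico, hget]
  constructor
  · rintro ⟨k, rfl, h1, h2⟩
    have hk : (k : ℕ) < r := by simpa [strictStaircase_parts_length] using k.2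
    exact ⟨h1, by omega⟩
  · rintro ⟨h1, h2⟩
    refine ⟨⟨i, by rw [strictStaircase_parts_length]; omega⟩, rfl, h1, ?_⟩
    simp only; omega

theorem strictStaircase_sum (r : ℕ) :
    (strictStaircase (r + 1)).parts.sum = ∑ c ∈ range r, stair r c := by
  have h : (strictStaircase (r + 1)).parts.sum = (List.range' 1 r).sum := by
    simp [strictStaircase, staircaseParts, List.sum_reverse]
  have h2 : (List.range' 1 r).sum = ∑ c ∈ range r, (c + 1) := by
    induction r with
    | zero => rfl
    | succ r ih =>
      rw [List.range'_concat, List.sum_append, ih, Finset.sum_range_succ]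
      · simp [add_comm]
      all_goals simp [strictStaircase, staircaseParts, List.sum_reverse]
  rw [h, h2, ← Finset.sum_range_reflect]
  refine Finset.sum_congr rfl fun c hc => ?_
  simp only [mem_range] at hc
  simp only [stair]; omega

/-- The time at which the letter `a` is used on the diagonal `c`. -/
def letterTime {n : ℕ} (r c : ℕ) (a : PrimedAlphabet n) : ℕ :=
  (ofLex a).1 * (2 * r - 1) + if (ofLex a).2 then r - 1 + c else r - 1 - c

theorem mul_add_lt_mul_add_iff {L s s' o o' : ℕ} (ho : o < L) (ho' : o' < L) :
    s * L + o < s' * L + o' ↔ s < s' ∨ s = s' ∧ o < o' := by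
  rcases lt_trichotomy s s' with h | rfl | h
  · have := Nat.mul_le_mul_right L h
    rw [Nat.succ_mul] at this
    constructor
    · exact fun _ => Or.inl h
    · intro _; omega
  · simp
  · have := Nat.mul_le_mul_right L h
    rw [Nat.succ_mul] at this
    constructor
    · intro _; omega
    · intro _; omega

theorem letterTime_lt_iff {n r c c' : ℕ} (hc : c < r) (hc' : c' < r) (a a' : PrimedAlphabet n) :
    letterTime r c a < letterTime r c' a' ↔ (ofLex a).1 < (ofLex a').1 ∨
      (ofLex a).1 = (ofLex a').1 ∧ (if (ofLex a).2 then r - 1 + c else r - 1 - c) <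
        (if (ofLex a').2 then r - 1 + c' else r - 1 - c') := by
  rw [letterTime, letterTime, mul_add_lt_mul_add_iff, Fin.lt_def, Fin.ext_iff]
  all_goals split_ifs <;> omega

theorem letterTime_div {n r c : ℕ} (hc : c < r) (a : PrimedAlphabet n) :
    letterTime r c a / (2 * r - 1) = (ofLex a).1 := by
  rw [letterTime, Nat.mul_comm, Nat.mul_add_div (by omega), Nat.div_eq_of_lt, add_zero]
  split_ifs <;> omega

theorem letterTime_mod {n r c : ℕ} (hc : c < r) (a : PrimedAlphabet n) :
    letterTime r c a % (2 * r - 1) = if (ofLex a).2 then r - 1 + c else r - 1 - c := by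
  rw [letterTime, Nat.mul_add_mod_of_lt]
  split_ifs <;> omega

theorem timeContent_letterTime {n r c : ℕ} (hc : c < r) (a : PrimedAlphabet n) :
    timeContent r (letterTime r c a) = c := by
  rw [timeContent, letterTime_mod hc, blockContent]
  split_ifs <;> omega

theorem letterTime_lt {n r c : ℕ} (hc : c < r) (a : PrimedAlphabet n) :
    letterTime r c a < n * (2 * r - 1) := by
  have h := (ofLex a).1.2
  have := Nat.mul_le_mul_right (2 * r - 1) h
  rw [Nat.succ_mul] at this
  rw [letterTime]
  split_ifs <;> omega

/-- On the main diagonal s' and s would share the time at offset r - 1; forbidding primes there is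
exactly what restores injectivity. -/
theorem letterTime_injective {n r c : ℕ} (hc : c < r) {a a' : PrimedAlphabet n}
    (ha : c = 0 → (ofLex a).2 = true) (ha' : c = 0 → (ofLex a').2 = true)
    (h : letterTime r c a = letterTime r c a') : a = a' := by
  have h1 := congrArg (· / (2 * r - 1)) h
  have h2 := congrArg (· % (2 * r - 1)) h
  simp only [letterTime_div hc] at h1
  simp only [letterTime_mod hc] at h2
  apply ofLex.injective
  refine Prod.ext (Fin.ext h1) ?_
  revert ha ha' h2
  generalize (ofLex a).2 = p
  generalize (ofLex a').2 = p'
  intro ha ha' h2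
  rcases Nat.eq_zero_or_pos c with h0 | h0
  · rw [ha h0, ha' h0]
  · cases p <;> cases p' <;> simp at h2 ⊢ <;> omega

theorem exists_letterTime_eq {n r t : ℕ} (ht : t < n * (2 * r - 1)) :
    ∃ a : PrimedAlphabet n, (timeContent r t = 0 → (ofLex a).2 = true) ∧
      letterTime r (timeContent r t) a = t := by
  have hL : 0 < 2 * r - 1 := by
    rcases Nat.eq_zero_or_pos (2 * r - 1) with h | h
    · rw [h] at ht; omega
    · exact h
  have hdiv : t / (2 * r - 1) < n := Nat.div_lt_of_lt_mul (by rwa [Nat.mul_comm])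
  have hmod := Nat.mod_lt t hL
  refine ⟨toLex (⟨t / (2 * r - 1), hdiv⟩, decide (r - 1 ≤ t % (2 * r - 1))), ?_, ?_⟩
  · intro h
    simp only [ofLex_toLex, decide_eq_true_eq]
    simp only [timeContent, blockContent] at h; omega
  · simp only [letterTime, ofLex_toLex, decide_eq_true_eq, timeContent, blockContent]
    conv_rhs => rw [← Nat.div_add_mod' t (2 * r - 1)]
    congr 1
    split_ifs <;> omega

theorem primedAlphabet_le_iff {n : ℕ} (a a' : PrimedAlphabet n) :
    a ≤ a' ↔ (ofLex a).1 < (ofLex a').1 ∨ (ofLex a).1 = (ofLex a').1 ∧ (ofLex a).2 ≤ (ofLex a').2 :=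
  Prod.Lex.le_iff

theorem letterTime_le_of_lt {n r c c' : ℕ} (hc : c < r) (hc' : c' < r) {a a' : PrimedAlphabet n}
    (h : letterTime r c a < letterTime r c' a') : a ≤ a' := by
  rw [letterTime_lt_iff hc hc'] at h
  rw [primedAlphabet_le_iff]
  refine h.imp id fun h => ⟨h.1, ?_⟩
  replace h := h.2
  revert h
  generalize (ofLex a).2 = p
  generalize (ofLex a').2 = p'
  cases p <;> cases p' <;> simp
  omega

/-- Consecutive boxes: equal letters must respect the order of the diagonals. -/
theorem letterTime_lt_of_le {n r c c' : ℕ} (hc : c < r) (hc' : c' < r) {a a' : PrimedAlphabet n}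
    (h : a ≤ a') (hu : ∀ s, a = unprimed s → a' = unprimed s → c < c')
    (hp : ∀ s, a = primed s → a' = primed s → c' < c) (hne : c ≠ c') :
    letterTime r c a < letterTime r c' a' := by
  rw [letterTime_lt_iff hc hc']
  rw [primedAlphabet_le_iff] at h
  refine h.imp id fun h => ⟨h.1, ?_⟩
  obtain ⟨⟨s, p⟩, rfl⟩ := toLex.surjective a
  obtain ⟨⟨s', p'⟩, rfl⟩ := toLex.surjective a'
  simp only [ofLex_toLex] at h ⊢
  obtain ⟨rfl, hle⟩ := h
  cases p <;> cases p'
  · have := hp s rfl rfl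
    simp; omega
  · simp; omega
  · exact absurd hle (by decide)
  · have := hu s rfl rfl
    simp; omega

namespace IsTimed

variable {r m : ℕ} {ct : ℕ → ℕ} {S : Finset (ℕ × ℕ)}

/-- The tableau conditions forbid repetitions anywhere in a row, not only in adjacent boxes; `cover`
supplies an entry in each box between. -/
theorem lt_of_row (h : IsTimed ct (stair r) m S) :
    ∀ (k i t t' : ℕ), (i, t) ∈ S → (i, t') ∈ S → ct t' = ct t + (k + 1) → t < t'
  | 0, i, t, t', ht, ht', e => h.right i t t' ht ht' e
  | k + 1, i, t, t', ht, ht', e => by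
    have h1 := (h.mem i t' ht').2
    obtain ⟨t'', h2, h3⟩ := h.cover (ct t + 1) i (by simp only [stair] at *; omega)
    exact (h.right i t t'' ht h2 h3).trans (lt_of_row h k i t'' t' h2 ht' (by omega))

theorem lt_of_column (h : IsTimed ct (stair r) m S) :
    ∀ (k i t t' : ℕ), (i, t) ∈ S → (i + (k + 1), t') ∈ S → ct t = ct t' + (k + 1) → t < t'
  | 0, i, t, t', ht, ht', e => h.down i t t' ht ht' e
  | k + 1, i, t, t', ht, ht', e => by
    have h1 := (h.mem i t ht).2
    obtain ⟨t'', h2, h3⟩ := h.cover (ct t - 1) (i + 1) (by simp only [stair] at *; omega)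
    exact (h.down i t t'' ht h2 (by omega)).trans
      (lt_of_column h k (i + 1) t'' t' h2 (by convert ht' using 2; omega) (by omega))

end IsTimed

/-- The diagonal of a box. -/
def boxContent {r : ℕ} (u : (strictStaircase (r + 1)).diagram) : ℕ := u.1.2 - u.1.1

theorem boxContent_spec {r : ℕ} (u : (strictStaircase (r + 1)).diagram) :
    u.1.2 = u.1.1 + boxContent u ∧ u.1.1 + boxContent u < r := by
  have := mem_strictStaircase_diagram.1 u.2
  unfold boxContent; omega

/-- The filling by times of a tableau. -/
def tableauTimes {n r : ℕ} (T : (strictStaircase (r + 1)).diagram → Finset (PrimedAlphabet n)) :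
    Finset (ℕ × ℕ) :=
  (univ.sigma T).image fun p => (p.1.1.1, letterTime r (boxContent p.1) p.2)

open Classical in
/-- The tableau of a filling by times. -/
def timesTableau (n r : ℕ) (S : Finset (ℕ × ℕ)) (u : (strictStaircase (r + 1)).diagram) :
    Finset (PrimedAlphabet n) :=
  univ.filter fun a => (boxContent u = 0 → (ofLex a).2 = true) ∧
    (u.1.1, letterTime r (boxContent u) a) ∈ S

section

variable {n r : ℕ}

theorem mem_timesTableau {S : Finset (ℕ × ℕ)} {u : (strictStaircase (r + 1)).diagram}
    {a : PrimedAlphabet n} : a ∈ timesTableau n r S u ↔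
      (boxContent u = 0 → (ofLex a).2 = true) ∧ (u.1.1, letterTime r (boxContent u) a) ∈ S := by
  simp [timesTableau]

theorem mem_tableauTimes {T : (strictStaircase (r + 1)).diagram → Finset (PrimedAlphabet n)}
    {p : ℕ × ℕ} : p ∈ tableauTimes T ↔
      ∃ u, ∃ a ∈ T u, u.1.1 = p.1 ∧ letterTime r (boxContent u) a = p.2 := by
  obtain ⟨i, t⟩ := p
  simp only [tableauTimes, mem_image, mem_sigma, mem_univ, true_and, Sigma.exists, Prod.mk.injEq]

theorem IsShiftedSetValuedTableau.unprimed_of_diag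
    {T : (strictStaircase (r + 1)).diagram → Finset (PrimedAlphabet n)}
    (hT : IsShiftedSetValuedTableau n _ T) {u : (strictStaircase (r + 1)).diagram}
    {a : PrimedAlphabet n} (ha : a ∈ T u) (h : boxContent u = 0) : (ofLex a).2 = true := by
  have hu := boxContent_spec u
  by_contra hcon
  refine hT.diag u (by omega) (ofLex a).1 ?_
  have : a = primed (ofLex a).1 := by
    apply ofLex.injective
    refine Prod.ext rfl ?_
    simpa [primed] using hcon
  rwa [← this]

theorem boxContent_lt (u : (strictStaircase (r + 1)).diagram) : boxContent u < r := by
  have := boxContent_spec u; omega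

theorem box_eq {u v : (strictStaircase (r + 1)).diagram} (h1 : u.1.1 = v.1.1)
    (h2 : boxContent u = boxContent v) : u = v := by
  have := boxContent_spec u
  have := boxContent_spec v
  exact Subtype.ext (Prod.ext h1 (by omega))

theorem mem_tableauTimes_iff {T : (strictStaircase (r + 1)).diagram → Finset (PrimedAlphabet n)}
    (hT : IsShiftedSetValuedTableau n _ T) {u : (strictStaircase (r + 1)).diagram}
    {a : PrimedAlphabet n} (ha : boxContent u = 0 → (ofLex a).2 = true) :
    (u.1.1, letterTime r (boxContent u) a) ∈ tableauTimes T ↔ a ∈ T u := by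
  rw [mem_tableauTimes]
  constructor
  · rintro ⟨v, a', ha', h1, h2⟩
    have hc := congrArg (timeContent r) h2
    rw [timeContent_letterTime (boxContent_lt v), timeContent_letterTime (boxContent_lt u)] at hc
    obtain rfl := box_eq h1 hc
    rwa [letterTime_injective (boxContent_lt v) ha (hT.unprimed_of_diag ha') h2.symm]
  · exact fun h => ⟨u, a, h, rfl, rfl⟩

theorem timesTableau_tableauTimes
    {T : (strictStaircase (r + 1)).diagram → Finset (PrimedAlphabet n)}
    (hT : IsShiftedSetValuedTableau n _ T) : timesTableau n r (tableauTimes T) = T := by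
  funext u
  ext a
  rw [mem_timesTableau]
  constructor
  · rintro ⟨h1, h2⟩; exact (mem_tableauTimes_iff hT h1).1 h2
  · intro h
    exact ⟨hT.unprimed_of_diag h, (mem_tableauTimes_iff hT (hT.unprimed_of_diag h)).2 h⟩

theorem card_tableauTimes {T : (strictStaircase (r + 1)).diagram → Finset (PrimedAlphabet n)}
    (hT : IsShiftedSetValuedTableau n _ T) : #(tableauTimes T) = tableauSize T := by
  rw [tableauTimes, Finset.card_image_of_injOn, Finset.card_sigma, tableauSize]
  rintro ⟨u, a⟩ h ⟨v, a'⟩ h' e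
  simp only [coe_sigma, Set.mem_sigma_iff, mem_coe, mem_univ, true_and] at h h'
  simp only [Prod.mk.injEq] at e
  have hc := congrArg (timeContent r) e.2
  rw [timeContent_letterTime (boxContent_lt v), timeContent_letterTime (boxContent_lt u)] at hc
  obtain rfl := box_eq e.1 hc
  rw [letterTime_injective (boxContent_lt u) (hT.unprimed_of_diag h) (hT.unprimed_of_diag h') e.2]

/-- The box in row `i` on the diagonal `c`. -/
def mkBox {i c : ℕ} (h : i < stair r c) : (strictStaircase (r + 1)).diagram :=
  ⟨(i, i + c), mem_strictStaircase_diagram.2 ⟨by simp, by simp [stair] at h ⊢; omega⟩⟩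

theorem boxContent_mkBox {i c : ℕ} (h : i < stair r c) : boxContent (mkBox h) = c := by
  simp [boxContent, mkBox]

theorem tableauTimes_timesTableau {S : Finset (ℕ × ℕ)}
    (hS : IsTimed (timeContent r) (stair r) (n * (2 * r - 1)) S) :
    tableauTimes (timesTableau n r S) = S := by
  ext ⟨i, t⟩
  rw [mem_tableauTimes]
  constructor
  · rintro ⟨u, a, ha, rfl, rfl⟩
    exact (mem_timesTableau.1 ha).2
  · intro h
    obtain ⟨ht, hi⟩ := hS.mem i t h
    obtain ⟨a, ha, hat⟩ := exists_letterTime_eq ht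
    refine ⟨mkBox hi, a, ?_, rfl, ?_⟩
    · rw [mem_timesTableau, boxContent_mkBox]
      exact ⟨ha, by rw [hat]; exact h⟩
    · rw [boxContent_mkBox]; exact hat

/-- For a fixed letter, time increases with the diagonal if it is unprimed and decreases if it is
primed. Diagonals grow along rows and shrink down columns, so strict increase in time encodes the
weak inequalities together with both repetition rules. -/
theorem isTimed_tableauTimes {T : (strictStaircase (r + 1)).diagram → Finset (PrimedAlphabet n)}
    (hT : IsShiftedSetValuedTableau n _ T) :
    IsTimed (timeContent r) (stair r) (n * (2 * r - 1)) (tableauTimes T) := by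
  refine ⟨fun i t h => ?_, fun c i h => ?_, fun i t t' h h' e => ?_, fun i t t' h h' e => ?_⟩
  · obtain ⟨u, a, ha, rfl, rfl⟩ := mem_tableauTimes.1 h
    have := boxContent_spec u
    refine ⟨letterTime_lt (boxContent_lt u) a, ?_⟩
    rw [timeContent_letterTime (boxContent_lt u), stair]
    omega
  · obtain ⟨a, ha⟩ := hT.nonempty (mkBox h)
    refine ⟨letterTime r c a, mem_tableauTimes.2 ⟨mkBox h, a, ha, rfl, ?_⟩, ?_⟩
    · rw [boxContent_mkBox]
    · exact timeContent_letterTime (by simp [stair] at h; omega) a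
  · obtain ⟨u, a, ha, hu, rfl⟩ := mem_tableauTimes.1 h
    obtain ⟨v, a', ha', hv, rfl⟩ := mem_tableauTimes.1 h'
    rw [timeContent_letterTime (boxContent_lt u), timeContent_letterTime (boxContent_lt v)] at e
    have hu' := boxContent_spec u
    have hv' := boxContent_spec v
    refine letterTime_lt_of_le (boxContent_lt u) (boxContent_lt v)
      (hT.row_le u v (Prod.ext (by simp; omega) (by simp; omega)) a ha a' ha') (fun _ _ _ => by omega) ?_ (by omega)
    rintro s rfl rfl
    have := congrArg boxContent (hT.row_primed s u v (by omega) ha ha')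
    omega
  · obtain ⟨u, a, ha, hu, rfl⟩ := mem_tableauTimes.1 h
    obtain ⟨v, a', ha', hv, rfl⟩ := mem_tableauTimes.1 h'
    rw [timeContent_letterTime (boxContent_lt u), timeContent_letterTime (boxContent_lt v)] at e
    have hu' := boxContent_spec u
    have hv' := boxContent_spec v
    refine letterTime_lt_of_le (boxContent_lt u) (boxContent_lt v)
      (hT.col_le u v (Prod.ext (by simp; omega) (by simp; omega)) a ha a' ha') ?_ (fun _ _ _ => by omega) (by omega)
    rintro s rfl rfl
    have := congrArg boxContent (hT.col_unprimed s u v (by omega) ha ha')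
    omega

theorem isShiftedSetValuedTableau_timesTableau {S : Finset (ℕ × ℕ)}
    (hS : IsTimed (timeContent r) (stair r) (n * (2 * r - 1)) S) :
    IsShiftedSetValuedTableau n (strictStaircase (r + 1)) (timesTableau n r S) := by
  have hct := fun (u : (strictStaircase (r + 1)).diagram) (a : PrimedAlphabet n) =>
    timeContent_letterTime (boxContent_lt u) a
  refine ⟨fun u => ?_, fun u v e a ha a' ha' => ?_, fun u v e a ha a' ha' => ?_,
    fun s u v e ha ha' => ?_, fun s u v e ha ha' => ?_, fun u e s h => ?_⟩
  · have hu := boxContent_spec u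
    obtain ⟨t, ht, hc⟩ := hS.cover (boxContent u) u.1.1 (by simp only [stair]; omega)
    obtain ⟨a, ha, hat⟩ := exists_letterTime_eq (hS.mem _ _ ht).1
    rw [hc] at ha hat
    exact ⟨a, mem_timesTableau.2 ⟨ha, by rwa [hat]⟩⟩
  · have hu := boxContent_spec u
    have hv := boxContent_spec v
    have e1 : v.1.1 = u.1.1 := by rw [e]
    have e2 : v.1.2 = u.1.2 + 1 := by rw [e]
    have h1 := (mem_timesTableau.1 ha).2
    have h2 := (mem_timesTableau.1 ha').2
    rw [e1] at h2
    exact letterTime_le_of_lt (boxContent_lt u) (boxContent_lt v)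
      (hS.right _ _ _ h1 h2 (by rw [hct, hct]; omega))
  · have hu := boxContent_spec u
    have hv := boxContent_spec v
    have e1 : v.1.1 = u.1.1 + 1 := by rw [e]
    have e2 : v.1.2 = u.1.2 := by rw [e]
    have h1 := (mem_timesTableau.1 ha).2
    have h2 := (mem_timesTableau.1 ha').2
    rw [e1] at h2
    exact letterTime_le_of_lt (boxContent_lt u) (boxContent_lt v)
      (hS.down _ _ _ h1 h2 (by rw [hct, hct]; omega))
  · have key : ∀ u v : (strictStaircase (r + 1)).diagram, u.1.2 = v.1.2 → u.1.1 < v.1.1 →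
        unprimed s ∈ timesTableau n r S u → unprimed s ∈ timesTableau n r S v → False := by
      intro u v e hlt ha ha'
      have hu := boxContent_spec u
      have hv := boxContent_spec v
      have h1 := (mem_timesTableau.1 ha).2
      have h2 := (mem_timesTableau.1 ha').2
      rw [show v.1.1 = u.1.1 + ((v.1.1 - u.1.1 - 1) + 1) by omega] at h2
      have := hS.lt_of_column _ _ _ _ h1 h2 (by rw [hct, hct]; omega)
      rw [letterTime_lt_iff (boxContent_lt u) (boxContent_lt v)] at this
      simp [unprimed] at this
      omega
    rcases lt_trichotomy u.1.1 v.1.1 with h | h | h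
    · exact (key u v e h ha ha').elim
    · exact Subtype.ext (Prod.ext h e)
    · exact (key v u e.symm h ha' ha).elim
  · have key : ∀ u v : (strictStaircase (r + 1)).diagram, u.1.1 = v.1.1 → u.1.2 < v.1.2 →
        primed s ∈ timesTableau n r S u → primed s ∈ timesTableau n r S v → False := by
      intro u v e hlt ha ha'
      have hu := boxContent_spec u
      have hv := boxContent_spec v
      have h1 := (mem_timesTableau.1 ha).2
      have h2 := (mem_timesTableau.1 ha').2
      rw [← e] at h2
      have := hS.lt_of_row (boxContent v - boxContent u - 1) _ _ _ h1 h2 (by rw [hct, hct]; omega)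
      rw [letterTime_lt_iff (boxContent_lt u) (boxContent_lt v)] at this
      simp [primed] at this
      omega
    rcases lt_trichotomy u.1.2 v.1.2 with h | h | h
    · exact (key u v e h ha ha').elim
    · exact Subtype.ext (Prod.ext e h)
    · exact (key v u e.symm h ha' ha).elim
  · have := (mem_timesTableau.1 h).1 (by unfold boxContent; omega)
    simp [primed] at this

theorem strictStaircase_sum_le_tableauSize
    {T : (strictStaircase (r + 1)).diagram → Finset (PrimedAlphabet n)}
    (hT : IsShiftedSetValuedTableau n _ T) :
    (strictStaircase (r + 1)).parts.sum ≤ tableauSize T := by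
  rw [strictStaircase_sum]
  have h1 : #(univ : Finset (strictStaircase (r + 1)).diagram) ≤ tableauSize T := by
    rw [Finset.card_eq_sum_ones]
    exact Finset.sum_le_sum fun u _ => (hT.nonempty u).card_pos
  refine le_trans ?_ h1
  have h2 : #((range r).sigma fun c => range (stair r c)) = ∑ c ∈ range r, stair r c := by
    simp [Finset.card_sigma]
  rw [← h2, Finset.card_univ, Fintype.card_coe]
  refine Finset.card_le_card_of_injOn (fun p => (p.2, p.2 + p.1)) ?_ ?_
  · rintro ⟨c, i⟩ h
    simp only [coe_sigma, Set.mem_sigma_iff, mem_coe, mem_range, stair] at h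
    rw [mem_coe, mem_strictStaircase_diagram]
    simp only; omega
  · rintro ⟨c, i⟩ - ⟨c', i'⟩ - h
    simp only [Prod.mk.injEq] at h
    obtain ⟨rfl, h⟩ := h
    obtain rfl : c = c' := by omega
    rfl

/-- Invertibility of b is needed because the excess is weighted as b^{#S} divided by b^{|μ|}. -/
theorem GP_ones_eq_stairSum {b : ℝ} (hb : b ≠ 0) (n r : ℕ) :
    GP (strictStaircase (r + 1)) (fun _ : Fin n => (1 : ℝ)) b =
      stairSum b r (List.replicate n 1) := by
  classical
  rw [← timedSum_stair hb, GP, timedSum]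
  have hd := stair_isShiftedShape r
  refine Finset.sum_nbij' tableauTimes (timesTableau n r) ?_ ?_ ?_ ?_ ?_
  · intro T hT
    rw [mem_timedFillings hd]
    exact isTimed_tableauTimes (mem_filter.1 hT).2
  · intro S hS
    rw [mem_timedFillings hd] at hS
    exact mem_filter.2 ⟨mem_univ _, isShiftedSetValuedTableau_timesTableau hS⟩
  · intro T hT
    exact timesTableau_tableauTimes (mem_filter.1 hT).2
  · intro S hS
    rw [mem_timedFillings hd] at hS
    exact tableauTimes_timesTableau hS
  · intro T hT
    have hT := (mem_filter.1 hT).2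
    rw [card_tableauTimes hT, ← strictStaircase_sum, inv_pow,
      pow_sub₀ b hb (strictStaircase_sum_le_tableauSize hT)]
    simp

end

/-! ### Comparison with the Holman series -/

theorem prod_Ioi_eq_prod_filter {M : Type*} [CommMonoid M] {n : ℕ} (f : Fin n → Fin n → M) :
    ∏ i, ∏ j ∈ Ioi i, f i j = ∏ p : Fin n × Fin n with p.1 < p.2, f p.1 p.2 := by
  rw [Finset.prod_filter, Fintype.prod_prod_type]
  refine Finset.prod_congr rfl fun i _ => ?_
  rw [← Finset.prod_filter]
  refine Finset.prod_congr ?_ fun _ _ => rfl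
  ext j; simp

/-- The differences of the exponents of the staircase `δ_{r+1}`. -/
def stairDiff (r i j : ℕ) : ℤ := ((r - i : ℕ) : ℤ) - ((r - j : ℕ) : ℤ) + j - i

theorem stairDiff_eq {n r i j : ℕ} (hi : i < n) (hj : j < n) :
    stairDiff r i j = (stairExp n r i : ℤ) - stairExp n r j := by
  unfold stairDiff stairExp; omega

/-- The numerator of the Weyl dimension formula for `δ_{r+1}` and `GL_n`. -/
def weylNum (n r : ℕ) : ℤ := ∏ p : Fin n × Fin n with p.1 < p.2, stairDiff r p.1 p.2

/-- The denominator of the Weyl dimension formula for `GL_n`. -/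
def weylDen (n : ℕ) : ℤ := ∏ p : Fin n × Fin n with p.1 < p.2, ((p.2 : ℕ) - (p.1 : ℕ) : ℤ)

theorem weylNum_ne_zero (n r : ℕ) : weylNum n r ≠ 0 := by
  refine Finset.prod_ne_zero_iff.2 fun p hp => ?_
  have h : (p.1 : ℕ) < p.2 := (mem_filter.1 hp).2
  unfold stairDiff; omega

theorem weylDen_ne_zero (n : ℕ) : weylDen n ≠ 0 := by
  refine Finset.prod_ne_zero_iff.2 fun p hp => ?_
  have h : (p.1 : ℕ) < p.2 := (mem_filter.1 hp).2
  omega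

/-- The Holman series of a staircase, cleared of denominators. -/
def holmanPoly (n r : ℕ) : Polynomial ℤ :=
  ∑ κ ∈ Fintype.piFinset fun j : Fin n => range ((j : ℕ) + 1),
    Polynomial.C ((∏ j : Fin n, (Nat.choose j (κ j) : ℤ)) *
      ∏ p : Fin n × Fin n with p.1 < p.2,
        (stairDiff r p.1 p.2 + (κ p.1 : ℤ) - (κ p.2 : ℤ))) * Polynomial.X ^ ∑ j, κ j

/-- The specialization of `GP` with all variables equal to one. -/
def tableauPoly (n : ℕ) (μ : StrictPartition) : Polynomial ℤ :=
  ∑ T ∈ SSVT n μ, Polynomial.X ^ (tableauSize T - μ.parts.sum)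

theorem eval₂_tableauPoly {R : Type*} [CommRing R] (n : ℕ) (μ : StrictPartition) (b : R) :
    (tableauPoly n μ).eval₂ (Int.castRingHom R) b = GP μ (fun _ : Fin n => (1 : R)) b := by
  simp [tableauPoly, GP, Polynomial.eval₂_finsetSum]

/-- Clearing denominators makes both sides integer polynomials in b, so agreement for all real b > 0
suffices. -/
theorem tableauPoly_mul_weylDen {n r : ℕ} (hr : r ≤ n) :
    tableauPoly n (strictStaircase (r + 1)) * Polynomial.C (weylDen n) = holmanPoly n r := by
  have hinj : Function.Injective (Polynomial.map (Int.castRingHom ℝ)) :=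
    Polynomial.map_injective _ Int.cast_injective
  apply hinj
  refine Polynomial.eq_of_infinite_eval_eq _ _ ((Set.Ioi_infinite (0 : ℝ)).mono fun b hb => ?_)
  have hb : 0 < b := hb
  have key := stairSum_ones hb hr
  rw [← GP_ones_eq_stairSum hb.ne', ← eval₂_tableauPoly] at key
  simp only [prod_Ioi_eq_prod_filter] at key
  rw [Set.mem_ofPred_eq, Polynomial.eval_map, Polynomial.eval_map, Polynomial.eval₂_mul,
    Polynomial.eval₂_C]
  -- Both products of differences in `key` are oriented opposite to `weylDen` and `stairDiff`, so
  -- the same sign appears on each side.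
  set ε : ℝ := ∏ p : Fin n × Fin n with p.1 < p.2, (-1 : ℝ)
  have hε : ε ≠ 0 := Finset.prod_ne_zero_iff.2 fun _ _ => by norm_num
  have e1 : ∏ p : Fin n × Fin n with p.1 < p.2, (((p.1 : ℕ) : ℝ) - ((p.2 : ℕ) : ℝ)) =
      ε * (weylDen n : ℝ) := by
    rw [weylDen, Int.cast_prod, ← Finset.prod_mul_distrib]
    refine Finset.prod_congr rfl fun p _ => ?_
    push_cast; ring
  have e2 : ∀ κ : Fin n → ℕ, ∏ p : Fin n × Fin n with p.1 < p.2,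
      (((stairExp n r p.2 + κ p.2 : ℕ) : ℝ) - (stairExp n r p.1 + κ p.1 : ℕ)) =
      ε * ∏ p : Fin n × Fin n with p.1 < p.2,
        ((stairDiff r p.1 p.2 : ℝ) + (κ p.1 : ℝ) - (κ p.2 : ℝ)) := by
    intro κ
    rw [← Finset.prod_mul_distrib]
    refine Finset.prod_congr rfl fun p _ => ?_
    rw [stairDiff_eq p.1.2 p.2.2]
    push_cast; ring
  simp only [e1, e2] at key
  refine mul_left_cancel₀ hε ?_
  calc ε * (_ * _) = _ := by rw [eq_intCast]; exact mul_left_comm _ _ _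
    _ = _ := key
    _ = _ := ?_
  rw [holmanPoly, Polynomial.eval₂_finsetSum, Finset.mul_sum]
  refine Finset.sum_congr rfl fun κ _ => ?_
  rw [Polynomial.eval₂_mul, Polynomial.eval₂_C, Polynomial.eval₂_X_pow]
  simp only [Finset.prod_mul_distrib, Finset.prod_pow_eq_pow_sum, map_mul, map_prod, map_sub,
    map_add, eq_intCast]
  push_cast
  ring

/-- The sign of the falling product is absorbed by (-b)^k, which is why the Holman series is taken
at -b. -/
theorem pochhammer_ratio {K : Type*} [Field K] [CharZero K] (i k : ℕ) (b : K) :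
    (ascPochhammer K k).eval (-(i : K)) * ((ascPochhammer K k).eval 1)⁻¹ * (-b) ^ k =
      (Nat.choose i k : K) * b ^ k := by
  rw [ascPochhammer_eval_neg_eq_descPochhammer, descPochhammer_eval_eq_descFactorial,
    ascPochhammer_eval_one, Nat.descFactorial_eq_factorial_mul_choose, neg_pow b]
  have h : (k.factorial : K) ≠ 0 := Nat.cast_ne_zero.2 k.factorial_ne_zero
  have h2 : ((-1 : K) ^ k) * (-1) ^ k = 1 := by rw [← mul_pow]; simp
  push_cast
  field_simp
  linear_combination (Nat.choose i k : K) * b ^ k * h2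

theorem rowLen_staircase (r i : ℕ) : (staircase (r + 1)).rowLen i = r - i := by
  have h : ∀ j, j < (staircase (r + 1)).rowLen i ↔ j < r - i := by
    intro j
    rw [← YoungDiagram.mem_iff_lt_rowLen, staircase, YoungDiagram.mem_ofRowLens]
    simp [staircaseParts, List.getElem_reverse]
    omega
  have h1 := h (r - i)
  have h2 := h ((staircase (r + 1)).rowLen i)
  omega

theorem holmanShape_mul_weylNum {K : Type*} [Field K] [CharZero K] (n r : ℕ) (b : K) :
    holmanShape n (staircase (r + 1)) (-b) * (weylNum n r : K) =
      (holmanPoly n r).eval₂ (Int.castRingHom K) b := by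
  have hA : ∀ i j : Fin n, ((staircase (r + 1)).rowLen i : K) - ((staircase (r + 1)).rowLen j : K) +
      ((j : ℕ) : K) - ((i : ℕ) : K) = (stairDiff r i j : K) := by
    intro i j
    rw [rowLen_staircase, rowLen_staircase, stairDiff]
    push_cast; rfl
  have hW : (weylNum n r : K) ≠ 0 := Int.cast_ne_zero.2 (weylNum_ne_zero n r)
  rw [holmanShape, holmanF]
  simp only [hA]
  have hterm : ∀ κ : Fin n → ℕ, holmanTerm (v := 1) (w := 1) (fun i j : Fin n => (stairDiff r i j : K))
      (fun i _ => -((i : ℕ) : K)) (fun _ _ => 1) (fun _ => -b) κ * (weylNum n r : K) =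
      (∏ j : Fin n, (Nat.choose j (κ j) : K) * b ^ κ j) *
        ∏ p : Fin n × Fin n with p.1 < p.2,
          ((stairDiff r p.1 p.2 : K) + (κ p.1 : K) - (κ p.2 : K)) := by
    intro κ
    simp only [holmanTerm, Finset.univ_unique, Finset.prod_singleton, ← pochhammer_ratio,
      Finset.prod_mul_distrib, Finset.prod_div_distrib]
    rw [weylNum] at hW ⊢
    push_cast at hW ⊢
    field_simp
  have hsupp : Function.support (holmanTerm (v := 1) (w := 1)
      (fun i j : Fin n => (stairDiff r i j : K)) (fun i _ => -((i : ℕ) : K)) (fun _ _ => 1)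
      (fun _ => -b)) ⊆ (Fintype.piFinset fun j : Fin n => range ((j : ℕ) + 1) : Finset (Fin n → ℕ)) := by
    intro κ hκ
    simp only [mem_coe, Fintype.mem_piFinset, mem_range]
    intro j
    by_contra hj
    apply hκ
    refine (mul_eq_zero.1 ((hterm κ).trans ?_)).resolve_right hW
    rw [Finset.prod_eq_zero (Finset.mem_univ j), zero_mul]
    rw [Nat.choose_eq_zero_of_lt (by omega)]
    simp
  rw [finsum_eq_sum_of_support_subset _ hsupp, Finset.sum_mul, holmanPoly,
    Polynomial.eval₂_finsetSum]
  refine Finset.sum_congr rfl fun κ _ => ?_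
  rw [hterm]
  rw [Polynomial.eval₂_mul, Polynomial.eval₂_C, Polynomial.eval₂_X_pow]
  simp only [Finset.prod_mul_distrib, Finset.prod_pow_eq_pow_sum, map_mul, map_prod, map_sub, map_add, eq_intCast]
  push_cast
  ring

/-- Only κ = 0 contributes. As the value is nonzero, the series does not vanish identically in b. -/
theorem holmanPoly_eval_zero (n r : ℕ) : (holmanPoly n r).eval 0 = weylNum n r := by
  rw [holmanPoly, Polynomial.eval_finsetSum, Finset.sum_eq_single (fun _ => 0)]
  · simp only [Polynomial.eval_mul, Polynomial.eval_C]
    simp [weylNum]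
  · intro κ _ hκ
    have : ∑ j, κ j ≠ 0 := by
      intro h
      exact hκ (funext fun j => by simpa using Finset.sum_eq_zero_iff.1 h j (mem_univ j))
    simp [this]
  · intro h
    simp at h

theorem GP_mul_weylDen {K : Type*} [Field K] [CharZero K] {n r : ℕ} (hr : r ≤ n) (b : K) :
    GP (strictStaircase (r + 1)) (fun _ : Fin n => (1 : K)) b * (weylDen n : K) =
      holmanShape n (staircase (r + 1)) (-b) * (weylNum n r : K) := by
  rw [holmanShape_mul_weylNum, ← tableauPoly_mul_weylDen hr, Polynomial.eval₂_mul, Polynomial.eval₂_C, eval₂_tableauPoly]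
  simp

/-! ### The ratio of consecutive dimensions -/

/-- Row i and the rows j ≤ r all gain one box, leaving their differences alone; for j > r the
difference rises by one, so the quotient telescopes in j. -/
theorem prod_stairDiff_succ {r i : ℕ} (hi : i ≤ r) : ∀ n, r + 1 ≤ n →
    (∏ j ∈ Ico (i + 1) n, stairDiff (r + 1) i j) * (2 * (r + 1) - 1 - 2 * i : ℤ) =
      (∏ j ∈ Ico (i + 1) n, stairDiff r i j) * ((n : ℤ) + (r + 1) - 1 - 2 * i) := by
  intro n hn
  induction n, hn using Nat.le_induction with
  | base =>
    congr 1
    · refine Finset.prod_congr rfl fun j hj => ?_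
      simp only [mem_Ico] at hj
      unfold stairDiff; omega
    · push_cast; ring
  | succ n hn ih =>
    rw [Finset.prod_Ico_succ_top (by omega), Finset.prod_Ico_succ_top (by omega)]
    have e1 : stairDiff (r + 1) i n = (n : ℤ) + (r + 1) - 2 * i := by unfold stairDiff; omega
    have e2 : stairDiff r i n = (n : ℤ) + (r + 1) - 1 - 2 * i := by unfold stairDiff; omega
    rw [e1, e2]
    push_cast
    linear_combination ((n : ℤ) + (r + 1) - 2 * i) * ih

theorem weylNum_eq_prod_range (n r : ℕ) :
    weylNum n r = ∏ i ∈ range n, ∏ j ∈ Ico (i + 1) n, stairDiff r i j := by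
  rw [weylNum, ← prod_Ioi_eq_prod_filter (fun i j => stairDiff r i j),
    ← Fin.prod_univ_eq_prod_range (fun i => ∏ j ∈ Ico (i + 1) n, stairDiff r i j)]
  refine Finset.prod_congr rfl fun i _ => ?_
  have h1 : Ioi i = univ.filter fun j : Fin n => (i : ℕ) < j := by ext j; simp
  have h2 : Ico ((i : ℕ) + 1) n = (range n).filter fun j => (i : ℕ) < j := by ext j; simp; omega
  rw [h1, h2, Finset.prod_filter, Finset.prod_filter,
    Fin.prod_univ_eq_prod_range (fun j => if (i : ℕ) < j then stairDiff r i j else 1)]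

theorem weylNum_succ {n r : ℕ} (hr : r + 1 ≤ n) :
    weylNum n (r + 1) * ∏ i ∈ range (r + 1), (2 * (r + 1) - 1 - 2 * i : ℤ) =
      weylNum n r * ∏ i ∈ range (r + 1), ((n : ℤ) + (r + 1) - 1 - 2 * i) := by
  have hext : ∀ f : ℕ → ℤ, ∏ i ∈ range (r + 1), f i =
      ∏ i ∈ range n, if i < r + 1 then f i else 1 := by
    intro f
    rw [← Finset.prod_filter]
    refine Finset.prod_congr ?_ fun _ _ => rfl
    ext i; simp; omega
  rw [hext, hext, weylNum_eq_prod_range, weylNum_eq_prod_range, ← Finset.prod_mul_distrib,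
    ← Finset.prod_mul_distrib]
  refine Finset.prod_congr rfl fun i _ => ?_
  split_ifs with h
  · exact prod_stairDiff_succ (by omega) n hr
  · rw [mul_one, mul_one]
    refine Finset.prod_congr rfl fun j hj => ?_
    simp only [mem_Ico] at hj
    unfold stairDiff; omega

theorem prod_odd_mul (k : ℕ) :
    (∏ i ∈ range k, (2 * k - 1 - 2 * i : ℂ)) * (2 ^ k * (k.factorial : ℂ)) = ((2 * k).factorial : ℂ) := by
  have h : ∏ i ∈ range k, (2 * k - 1 - 2 * i : ℂ) = ∏ i ∈ range k, (2 * i + 1 : ℂ) := by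
    rw [← Finset.prod_range_reflect]
    refine Finset.prod_congr rfl fun i hi => ?_
    have hi : i < k := by simpa using hi
    rw [Nat.cast_sub (by omega), Nat.cast_sub (by omega)]
    push_cast; ring
  rw [h]
  clear h
  induction k with
  | zero => simp
  | succ k ih =>
    rw [Finset.prod_range_succ, show 2 * (k + 1) = 2 * k + 1 + 1 by ring, Nat.factorial_succ,
      Nat.factorial_succ, Nat.factorial_succ]
    push_cast
    rw [← ih]
    ring

/-- At z = -1 the factor (z + 1)/2 kills every term but the last, so p is irrelevant and (-1)^k
binom(k + q, k) remains. -/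
theorem jacobiP_neg_one (k n : ℕ) (p : ℂ) :
    jacobiP k p ((-(n : ℂ) - k - 1) / 2) (-1) * (2 ^ k * (k.factorial : ℂ)) =
      ∏ i ∈ range k, ((n : ℂ) + k - 1 - 2 * i) := by
  have hk : (k.factorial : ℂ) ≠ 0 := Nat.cast_ne_zero.2 k.factorial_ne_zero
  rw [jacobiP, Finset.sum_eq_single k]
  · have h := Ring.descPochhammer_eq_factorial_smul_choose ((k : ℂ) + (-(n : ℂ) - k - 1) / 2) k
    rw [Polynomial.descPochhammer_smeval_eq_ascPochhammer, Polynomial.ascPochhammer_smeval_eq_eval,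
      ← descPochhammer_eval_eq_ascPochhammer, descPochhammer_eval_eq_prod_range, nsmul_eq_mul] at h
    -- Reversing the product, each factor k + q - i of the falling factorial becomes a factor on the
    -- left after multiplication by -2.
    have h2 : ∏ i ∈ range k, ((n : ℂ) + k - 1 - 2 * i) =
        (∏ i ∈ range k, ((k : ℂ) + (-(n : ℂ) - k - 1) / 2 - i)) * ∏ i ∈ range k, (-2 : ℂ) := by
      rw [← Finset.prod_mul_distrib, ← Finset.prod_range_reflect]
      refine Finset.prod_congr rfl fun i hi => ?_
      have hi : i < k := by simpa using hi
      rw [Nat.cast_sub (by omega), Nat.cast_sub (by omega)]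
      push_cast; ring
    rw [h2, h]
    simp only [Nat.sub_self, Ring.choose_zero_right, pow_zero, mul_one, one_mul, Finset.prod_const,
      card_range]
    rw [show ((-1 : ℂ) - 1) / 2 = -1 by norm_num, neg_pow (2 : ℂ)]
    ring
  · intro i hi hne
    have hi : i < k + 1 := by simpa using hi
    rw [show ((-1 : ℂ) + 1) / 2 = 0 by norm_num, zero_pow (by omega)]
    ring
  · simp

theorem weylNum_ratio {n r : ℕ} (hr : r + 1 ≤ n) :
    (weylNum n (r + 1) : ℂ) = (2 : ℂ) ^ (2 * (r + 1)) * ((r + 1).factorial : ℂ) ^ 2 /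
      ((2 * (r + 1)).factorial : ℂ) * jacobiP (r + 1) (((n : ℂ) - (r + 1 : ℕ) - 1) / 2)
        ((-(n : ℂ) - (r + 1 : ℕ) - 1) / 2) (-1) * weylNum n r := by
  have h1 := congrArg (Int.cast : ℤ → ℂ) (weylNum_succ hr)
  have h2 := jacobiP_neg_one (r + 1) n (((n : ℂ) - (r + 1 : ℕ) - 1) / 2)
  have h3 := prod_odd_mul (r + 1)
  push_cast at h1 h2 h3 ⊢
  have hf : ((2 * (r + 1)).factorial : ℂ) ≠ 0 := Nat.cast_ne_zero.2 (Nat.factorial_ne_zero _)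
  have hf' : ((r + 1).factorial : ℂ) ≠ 0 := Nat.cast_ne_zero.2 (Nat.factorial_ne_zero _)
  rw [← h2] at h1
  rw [div_mul_eq_mul_div, div_mul_eq_mul_div, eq_div_iff hf, ← h3]
  linear_combination (2 ^ (r + 1) * ((r + 1).factorial : ℂ)) * h1

/-! ### Nonvanishing and the final identity -/

theorem holmanShape_ratFunc_ne_zero (n r : ℕ) :
    holmanShape n (staircase (r + 1)) (-RatFunc.X : RatFunc ℂ) ≠ 0 := by
  intro h
  have h1 := holmanShape_mul_weylNum n r (RatFunc.X : RatFunc ℂ)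
  rw [h, zero_mul] at h1
  have h2 : (holmanPoly n r).eval₂ (Int.castRingHom (RatFunc ℂ)) RatFunc.X =
      algebraMap (Polynomial ℂ) (RatFunc ℂ) ((holmanPoly n r).map (Int.castRingHom ℂ)) := by
    rw [← RatFunc.algebraMap_X, Polynomial.map, Polynomial.hom_eval₂]
    congr 1
    exact RingHom.ext_int _ _
  rw [h2, eq_comm, map_eq_zero_iff _ (RatFunc.algebraMap_injective ℂ),
    Polynomial.map_eq_zero_iff Int.cast_injective] at h1
  apply weylNum_ne_zero n r
  rw [← holmanPoly_eval_zero, h1, Polynomial.eval_zero]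

theorem GP_ne_zero_iff {K : Type*} [Field K] [CharZero K] {n r : ℕ} (hr : r ≤ n) (b : K) :
    GP (strictStaircase (r + 1)) (fun _ : Fin n => (1 : K)) b ≠ 0 ↔
      holmanShape n (staircase (r + 1)) (-b) ≠ 0 := by
  have h := GP_mul_weylDen hr b
  have hD : (weylDen n : K) ≠ 0 := Int.cast_ne_zero.2 (weylDen_ne_zero n)
  have hN : (weylNum n r : K) ≠ 0 := Int.cast_ne_zero.2 (weylNum_ne_zero n r)
  rw [not_iff_not]
  constructor
  · intro h0; rw [h0, zero_mul] at h; exact (mul_eq_zero.1 h.symm).resolve_right hN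
  · intro h0; rw [h0, zero_mul] at h; exact (mul_eq_zero.1 h).resolve_right hD

theorem GP_ratio {K : Type*} [Field K] [CharZero K] {n r : ℕ} (hr : r + 1 ≤ n) (b c : K)
    (hc : (weylNum n (r + 1) : K) = c * weylNum n r)
    (h0 : GP (strictStaircase (r + 1)) (fun _ : Fin n => (1 : K)) b ≠ 0) :
    GP (strictStaircase (r + 1 + 1)) (fun _ : Fin n => (1 : K)) b /
        GP (strictStaircase (r + 1)) (fun _ : Fin n => (1 : K)) b =
      c * (holmanShape n (staircase (r + 1 + 1)) (-b) / holmanShape n (staircase (r + 1)) (-b)) := by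
  have h1 := GP_mul_weylDen hr b
  have h2 := GP_mul_weylDen (show r ≤ n by omega) b
  have h0' := (GP_ne_zero_iff (by omega) b).1 h0
  have hD : (weylDen n : K) ≠ 0 := Int.cast_ne_zero.2 (weylDen_ne_zero n)
  have hN : (weylNum n r : K) ≠ 0 := Int.cast_ne_zero.2 (weylNum_ne_zero n r)
  rw [mul_div_assoc', div_eq_div_iff h0 h0']
  refine mul_right_cancel₀ hD (mul_right_cancel₀ hN ?_)
  rw [hc] at h1
  linear_combination (holmanShape n (staircase (r + 1)) (-b) * (weylNum n r : K)) * h1 -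
    (c * holmanShape n (staircase (r + 1 + 1)) (-b) * (weylNum n r : K)) * h2

end

theorem proposition4p9 (k n : ℕ) (hk : 1 ≤ k) (hkn : k ≤ n) :
    (GP (strictStaircase k) (fun _ : Fin n => (1 : RatFunc ℂ)) RatFunc.X ≠ 0 ∧
      holmanShape n (staircase k) (-RatFunc.X : RatFunc ℂ) ≠ 0 ∧
      GP (strictStaircase (k + 1)) (fun _ : Fin n => (1 : RatFunc ℂ)) RatFunc.X /
          GP (strictStaircase k) (fun _ : Fin n => (1 : RatFunc ℂ)) RatFunc.X =
        RatFunc.C ((2 : ℂ) ^ (2 * k) * (k.factorial : ℂ) ^ 2 / ((2 * k).factorial : ℂ) *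
            jacobiP k (((n : ℂ) - k - 1) / 2) ((-(n : ℂ) - k - 1) / 2) (-1)) *
          (holmanShape n (staircase (k + 1)) (-RatFunc.X : RatFunc ℂ) /
            holmanShape n (staircase k) (-RatFunc.X : RatFunc ℂ))) ∧
    (∀ b : ℂ, GP (strictStaircase k) (fun _ : Fin n => (1 : ℂ)) b ≠ 0 →
      holmanShape n (staircase k) (-b) ≠ 0 ∧
      GP (strictStaircase (k + 1)) (fun _ : Fin n => (1 : ℂ)) b /
          GP (strictStaircase k) (fun _ : Fin n => (1 : ℂ)) b =
        (2 : ℂ) ^ (2 * k) * (k.factorial : ℂ) ^ 2 / ((2 * k).factorial : ℂ) *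
            jacobiP k (((n : ℂ) - k - 1) / 2) ((-(n : ℂ) - k - 1) / 2) (-1) *
          (holmanShape n (staircase (k + 1)) (-b) /
            holmanShape n (staircase k) (-b))) := by
  obtain ⟨r, rfl⟩ : ∃ r, k = r + 1 := ⟨k - 1, by omega⟩
  have hr : r ≤ n := by omega
  have hc := weylNum_ratio hkn
  have : CharZero (RatFunc ℂ) := charZero_of_injective_algebraMap (algebraMap ℂ (RatFunc ℂ)).injective
  have hX := holmanShape_ratFunc_ne_zero n r
  have hG := (GP_ne_zero_iff hr (RatFunc.X : RatFunc ℂ)).2 hX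
  refine ⟨⟨hG, hX, GP_ratio hkn _ _ ?_ hG⟩, fun b hb =>
    ⟨(GP_ne_zero_iff hr b).1 hb, GP_ratio hkn _ _ hc hb⟩⟩
  have := congrArg (RatFunc.C : ℂ →+* RatFunc ℂ) hc
  rw [map_mul, map_intCast, map_intCast] at this
  exact this
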